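/- Let $(\Omega,\mathcal F)$ be a measurable space and $\mathcal P$ a non-empty set of probability measures on it, with upper probability $c(A)=\sup_{P\in\mathcal P}P(A)$, $A\in\mathcal F$. An event $A$ is polar if $c(A)=0$. Let $L^0_c$ be the space of real-valued random variables modulo equality outside a polar event, ordered by $[f]\preccurlyeq[g]$ iff $\{f>g\}$ is polar; let $L^0_{c+}$ be its positive cone, $L^\infty_c=\{X\in L^0_c : |X|\preccurlyeq m \text{ for some real } m>0\}$ and $L^\infty_{c+}=L^\infty_c\cap L^0_{c+}$. Let $ca_c$ be the space of finite signed measures $\mu$ on $\mathcal F$ that vanish on all polar events, $ca_{c+}$ the set of its non-negative elements, and $\mathfrak P_c$ the set of probability measures in $ca_c$. A measure $\mu\in ca_{c+}$ is supported if there is $S\in\mathcal F$ with $\mu(S^c)=0$ such that, for every $N\in\mathcal F$, $\mu(N\cap S)=0$ implies that $N\cap S$ is polar. Let $sca_c$ be the set of $\mu\in ca_c$ whose total variation $|\mu|$ is supported, and $sca_{c+}=sca_c\cap ca_{c+}$. For $Q\in\mathfrak P_c$ let $L^0_Q$ be the space of random variables modulo $Q$-a.s. equality and $j_Q:L^0_c\to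 L^0_Q$ the canonical map. A non-empty set $\mathcal Q\subset\mathfrak P_c$ is a reduction set for $\mathcal C\subset L^0_c$ if $\mathcal C=\bigcap_{Q\in\mathcal Q}j_Q^{-1}(j_Q(\mathcal C))$; $\mathcal C$ is $\mathcal P$-sensitive if $\mathcal C=\bigcap_{Q\in\mathfrak P_c}j_Q^{-1}(j_Q(\mathcal C))$. A set $\mathcal C\subset L^0_{c+}$ is solid if $X\in\mathcal C$, $Y\in L^0_{c+}$ and $Y\preccurlyeq X$ imply $Y\in\mathcal C$. A set $\mathcal C\subset L^0_c$ is sequentially order closed if $X\in\mathcal C$ whenever $X\in L^0_c$ and there are a sequence $(X_n)$ in $\mathcal C$ and a decreasing sequence $(Y_n)$ in $L^0_c$ with $\inf_n Y_n=0$ in $(L^0_c,\preccurlyeq)$ and $|X_n-X|\preccurlyeq Y_n$ for all $n$. Let $\mathcal C\subset L^0_{c+}$ be non-empty and put $$\mathcal C^{\circ}=\{(Q,Z)\in\mathfrak P_c\times L^\infty_{c+} : E_Q[ZX]\le 1\ \forall X\in\mathcal C\},\qquad \mathcal C^{\circ\circ}=\{X\in L^0_{c+} : E_Q[ZX]\le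 1\ \forall (Q,Z)\in\mathcal C^\circ\},$$ $$\mathcal C^{\circ}_{ca}=\Big\{\mu\in ca_{c+} : \int X\,d\mu\le 1\ \forall X\in\mathcal C\Big\},\qquad \mathcal C^{\circ\circ}_{ca}=\Big\{X\in L^0_{c+} : \int X\,d\mu\le 1\ \forall \mu\in\mathcal C^\circ_{ca}\Big\},$$ and define $\mathcal C^\circ_{sca}$, $\mathcal C^{\circ\circ}_{sca}$ in the same way with $sca_{c+}$ in place of $ca_{c+}$. Then: 1. $\mathcal C^{\circ\circ}_{ca}=\mathcal C^{\circ\circ}$. 2. $\mathcal C=\mathcal C^{\circ\circ}_{ca}$ if and only if $\mathcal C$ is convex, solid, sequentially order closed and $\mathcal P$-sensitive. 3. If $\mathcal C$ is convex, solid and sequentially order closed, and has a reduction set $\mathcal Q\subset\mathfrak P_c\cap sca_c$, then $\mathcal C=\mathcal C^{\circ\circ}=\mathcal C^{\circ\circ}_{sca}$. 4. $\mathcal C^\circ_{ca}$ and $\mathcal C^\circ_{sca}$ are convex; they are solid, in the sense that $\mu\in\mathcal C^\circ_{ca}$ (resp. $\mathcal C^\circ_{sca}$), $\nu\in ca_{c+}$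 (resp. $sca_{c+}$) and $\nu(A)\le\mu(A)$ for all $A\in\mathcal F$ imply $\nu\in\mathcal C^\circ_{ca}$ (resp. $\mathcal C^\circ_{sca}$); and they are closed in $ca_c$ for $\sigma(ca_c,L^\infty_c)$, respectively in $sca_c$ for $\sigma(sca_c,L^\infty_c)$. Here $\sigma(M,L^\infty_c)$ is the coarsest topology on $M$ for which $\mu\mapsto\int X\,d\mu$ is continuous for every $X\in L^\infty_c$. -/

import Mathlib

open MeasureTheory
open scoped ENNReal Topology

namespace RobustModel

variable {Ω : Type*} [MeasurableSpace Ω]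

section Basics

/-- The upper probability `c(A) = sup_{P ∈ 𝓟} P(A)`. -/
noncomputable def upperProb (𝓟 : Set (ProbabilityMeasure Ω)) (A : Set Ω) : ℝ≥0∞ :=
  ⨆ P ∈ 𝓟, (P : Measure Ω) A

/-- `𝓟`-polar sets: `c(A) = 0`. It is only used for measurable sets `A`. -/
def IsPolar (𝓟 : Set (ProbabilityMeasure Ω)) (A : Set Ω) : Prop :=
  upperProb 𝓟 A = 0

theorem isPolar_iff {𝓟 : Set (ProbabilityMeasure Ω)} {A : Set Ω} :
    IsPolar 𝓟 A ↔ ∀ P ∈ 𝓟, (P : Measure Ω) A = 0 := by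
  simp [IsPolar, upperProb]

theorem IsPolar.mono {𝓟 : Set (ProbabilityMeasure Ω)} {A B : Set Ω} (hB : IsPolar 𝓟 B)
    (h : A ⊆ B) : IsPolar 𝓟 A :=
  isPolar_iff.2 fun P hP => measure_mono_null h (isPolar_iff.1 hB P hP)

theorem IsPolar.union {𝓟 : Set (ProbabilityMeasure Ω)} {A B : Set Ω} (hA : IsPolar 𝓟 A)
    (hB : IsPolar 𝓟 B) : IsPolar 𝓟 (A ∪ B) :=
  isPolar_iff.2 fun P hP => measure_union_null (isPolar_iff.1 hA P hP) (isPolar_iff.1 hB P hP)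

theorem isPolar_empty (𝓟 : Set (ProbabilityMeasure Ω)) : IsPolar 𝓟 (∅ : Set Ω) :=
  isPolar_iff.2 fun _ _ => measure_empty

variable (Ω) in
/-- The algebra `𝓛⁰` of all real-valued random variables. -/
def RV : Subalgebra ℝ (Ω → ℝ) where
  carrier := {f | Measurable f}
  mul_mem' hf hg := Measurable.mul hf hg
  add_mem' hf hg := Measurable.add hf hg
  algebraMap_mem' _ := measurable_const

theorem RV.measurable (f : RV Ω) : Measurable (f : Ω → ℝ) := f.2

/-- The random variables `f` with `c(|f| > 0) = 0`. -/
def nullRV (𝓟 : Set (ProbabilityMeasure Ω)) : Ideal (RV Ω) where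
  carrier := {f | IsPolar 𝓟 {ω | 0 < |(f : Ω → ℝ) ω|}}
  add_mem' {f g} hf hg := by
    refine (IsPolar.union hf hg).mono fun ω h => ?_
    by_contra hc
    simp_all
  zero_mem' := by simpa using isPolar_empty 𝓟
  smul_mem' a f hf := by
    refine IsPolar.mono hf fun ω h => ?_
    by_contra hc
    simp_all

theorem mem_nullRV {𝓟 : Set (ProbabilityMeasure Ω)} {f : RV Ω} :
    f ∈ nullRV 𝓟 ↔ IsPolar 𝓟 {ω | 0 < |(f : Ω → ℝ) ω|} := Iff.rfl

/-- `L⁰_c`: random variables modulo `𝓟`-quasi-sure equality. -/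
def L0 (𝓟 : Set (ProbabilityMeasure Ω)) : Type _ := RV Ω ⧸ nullRV 𝓟

noncomputable instance (𝓟 : Set (ProbabilityMeasure Ω)) : CommRing (L0 𝓟) :=
  inferInstanceAs (CommRing (RV Ω ⧸ nullRV 𝓟))

noncomputable instance (𝓟 : Set (ProbabilityMeasure Ω)) : Algebra ℝ (L0 𝓟) :=
  inferInstanceAs (Algebra ℝ (RV Ω ⧸ nullRV 𝓟))

/-- The equivalence class `[f]_c`. -/
def L0.mk (𝓟 : Set (ProbabilityMeasure Ω)) (f : RV Ω) : L0 𝓟 := Ideal.Quotient.mk (nullRV 𝓟) f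

theorem L0.mk_eq {𝓟 : Set (ProbabilityMeasure Ω)} {f g : RV Ω} :
    L0.mk 𝓟 f = L0.mk 𝓟 g ↔ IsPolar 𝓟 {ω | (f : Ω → ℝ) ω ≠ (g : Ω → ℝ) ω} := by
  refine (Ideal.Quotient.eq).trans ?_
  rw [mem_nullRV]
  simp [sub_eq_zero]

/-- A function on random variables that does not see quasi-sure modifications descends to `L⁰_c`. -/
def L0.lift {𝓟 : Set (ProbabilityMeasure Ω)} {α : Sort*} (F : RV Ω → α)
    (h : ∀ f g : RV Ω, IsPolar 𝓟 {ω | (f : Ω → ℝ) ω ≠ (g : Ω → ℝ) ω} → F f = F g)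
    (X : L0 𝓟) : α :=
  Quotient.liftOn' X F fun f g hfg =>
    h f g (L0.mk_eq.1 (Quotient.sound' hfg))

@[simp] theorem L0.lift_mk {𝓟 : Set (ProbabilityMeasure Ω)} {α : Sort*} (F : RV Ω → α)
    (h : ∀ f g : RV Ω, IsPolar 𝓟 {ω | (f : Ω → ℝ) ω ≠ (g : Ω → ℝ) ω} → F f = F g)
    (f : RV Ω) : L0.lift F h (L0.mk 𝓟 f) = F f := rfl

theorem L0.ind {𝓟 : Set (ProbabilityMeasure Ω)} {p : L0 𝓟 → Prop} (h : ∀ f, p (L0.mk 𝓟 f))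
    (X : L0 𝓟) : p X :=
  Quotient.inductionOn' X h

/-- Pointwise maximum of random variables. -/
def RV.max (f g : RV Ω) : RV Ω :=
  ⟨fun ω => (f : Ω → ℝ) ω ⊔ (g : Ω → ℝ) ω, (RV.measurable f).sup (RV.measurable g)⟩

/-- Pointwise minimum of random variables. -/
def RV.min (f g : RV Ω) : RV Ω :=
  ⟨fun ω => (f : Ω → ℝ) ω ⊓ (g : Ω → ℝ) ω, (RV.measurable f).inf (RV.measurable g)⟩

@[simp] theorem RV.max_apply (f g : RV Ω) (ω : Ω) :
    (RV.max f g : Ω → ℝ) ω = (f : Ω → ℝ) ω ⊔ (g : Ω → ℝ) ω := rfl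

@[simp] theorem RV.min_apply (f g : RV Ω) (ω : Ω) :
    (RV.min f g : Ω → ℝ) ω = (f : Ω → ℝ) ω ⊓ (g : Ω → ℝ) ω := rfl

/-- The `𝓟`-quasi-sure order: `[f] ≼ [g]` iff `{f > g}` is `𝓟`-polar. -/
instance (𝓟 : Set (ProbabilityMeasure Ω)) : LE (L0 𝓟) where
  le X Y := L0.lift (fun f => L0.lift (fun g => IsPolar 𝓟 {ω | (g : Ω → ℝ) ω < (f : Ω → ℝ) ω})
    (fun g g' h => propext ⟨
      fun h1 => (h1.union h).mono fun ω hω => by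
        by_contra hc
        simp_all [not_or]
        linarith,
      fun h1 => (h1.union h).mono fun ω hω => by
        by_contra hc
        simp_all [not_or]
        linarith⟩) Y)
    (fun f f' h => by
      induction Y using L0.ind with | h g => ?_
      simp only [L0.lift_mk]
      exact propext ⟨
        fun h1 => (h1.union h).mono fun ω hω => by
          by_contra hc
          simp_all [not_or]
          linarith,
        fun h1 => (h1.union h).mono fun ω hω => by
          by_contra hc
          simp_all [not_or]
          linarith⟩) X

theorem L0.mk_le {𝓟 : Set (ProbabilityMeasure Ω)} {f g : RV Ω} :
    L0.mk 𝓟 f ≤ L0.mk 𝓟 g ↔ IsPolar 𝓟 {ω | (g : Ω → ℝ) ω < (f : Ω → ℝ) ω} := Iff.rfl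

/-- `[f] ⊔ [g] = [f ∨ g]` and `[f] ⊓ [g] = [f ∧ g]`. -/
noncomputable instance (𝓟 : Set (ProbabilityMeasure Ω)) : Lattice (L0 𝓟) where
  le_refl X := by
    induction X using L0.ind with | h f => ?_
    simpa [L0.mk_le] using isPolar_empty 𝓟
  le_trans X Y Z := by
    induction X using L0.ind with | h f => ?_
    induction Y using L0.ind with | h g => ?_
    induction Z using L0.ind with | h k => ?_
    simp only [L0.mk_le]
    refine fun h1 h2 => (h1.union h2).mono fun ω hω => ?_
    by_contra hc
    simp_all [not_or]
    linarith
  le_antisymm X Y := by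
    induction X using L0.ind with | h f => ?_
    induction Y using L0.ind with | h g => ?_
    simp only [L0.mk_le, L0.mk_eq]
    exact fun h1 h2 => (h1.union h2).mono fun ω hω => (lt_or_gt_of_ne hω).symm
  sup X Y := Quotient.map₂ RV.max (fun f f' h g g' h' => by
    have h : L0.mk 𝓟 f = L0.mk 𝓟 f' := Quotient.sound h
    have h' : L0.mk 𝓟 g = L0.mk 𝓟 g' := Quotient.sound h'
    rw [L0.mk_eq] at h h'
    refine Quotient.exact (L0.mk_eq.2 ((h.union h').mono fun ω hω => ?_))
    by_contra hc
    simp_all [not_or]) X Y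
  inf X Y := Quotient.map₂ RV.min (fun f f' h g g' h' => by
    have h : L0.mk 𝓟 f = L0.mk 𝓟 f' := Quotient.sound h
    have h' : L0.mk 𝓟 g = L0.mk 𝓟 g' := Quotient.sound h'
    rw [L0.mk_eq] at h h'
    refine Quotient.exact (L0.mk_eq.2 ((h.union h').mono fun ω hω => ?_))
    by_contra hc
    simp_all [not_or]) X Y
  le_sup_left X Y := by
    induction X using L0.ind with | h f => ?_
    induction Y using L0.ind with | h g => ?_
    change L0.mk 𝓟 f ≤ L0.mk 𝓟 (RV.max f g)
    simpa [L0.mk_le] using isPolar_empty 𝓟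
  le_sup_right X Y := by
    induction X using L0.ind with | h f => ?_
    induction Y using L0.ind with | h g => ?_
    change L0.mk 𝓟 g ≤ L0.mk 𝓟 (RV.max f g)
    simpa [L0.mk_le] using isPolar_empty 𝓟
  sup_le X Y Z := by
    induction X using L0.ind with | h f => ?_
    induction Y using L0.ind with | h g => ?_
    induction Z using L0.ind with | h k => ?_
    change L0.mk 𝓟 f ≤ L0.mk 𝓟 k → L0.mk 𝓟 g ≤ L0.mk 𝓟 k →
      L0.mk 𝓟 (RV.max f g) ≤ L0.mk 𝓟 k
    simp only [L0.mk_le]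
    exact fun h1 h2 => (h1.union h2).mono fun ω hω => by
      simpa [lt_sup_iff] using hω
  inf_le_left X Y := by
    induction X using L0.ind with | h f => ?_
    induction Y using L0.ind with | h g => ?_
    change L0.mk 𝓟 (RV.min f g) ≤ L0.mk 𝓟 f
    simpa [L0.mk_le] using isPolar_empty 𝓟
  inf_le_right X Y := by
    induction X using L0.ind with | h f => ?_
    induction Y using L0.ind with | h g => ?_
    change L0.mk 𝓟 (RV.min f g) ≤ L0.mk 𝓟 g
    simpa [L0.mk_le] using isPolar_empty 𝓟
  le_inf X Y Z := by
    induction X using L0.ind with | h f => ?_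
    induction Y using L0.ind with | h g => ?_
    induction Z using L0.ind with | h k => ?_
    change L0.mk 𝓟 f ≤ L0.mk 𝓟 g → L0.mk 𝓟 f ≤ L0.mk 𝓟 k →
      L0.mk 𝓟 f ≤ L0.mk 𝓟 (RV.min g k)
    simp only [L0.mk_le]
    exact fun h1 h2 => (h1.union h2).mono fun ω hω => by
      simpa [inf_lt_iff] using hω

/-- The positive cone `L⁰_{c+}`. -/
def L0Pos (𝓟 : Set (ProbabilityMeasure Ω)) : Set (L0 𝓟) := {X | 0 ≤ X}

/-- `L^∞_c`: the classes `X` with `|X| ≼ m` for some constant `m > 0`. -/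
def Linf (𝓟 : Set (ProbabilityMeasure Ω)) : Set (L0 𝓟) :=
  {X | ∃ m : ℝ, 0 < m ∧ |X| ≤ algebraMap ℝ (L0 𝓟) m}

/-- The positive cone `L^∞_{c+}`. -/
def LinfPos (𝓟 : Set (ProbabilityMeasure Ω)) : Set (L0 𝓟) := Linf 𝓟 ∩ L0Pos 𝓟

end Basics

section Measures

/-- `𝔓_c(Ω)`: the probability measures `Q ≪ 𝓟`. -/
def Pc (𝓟 : Set (ProbabilityMeasure Ω)) : Set (ProbabilityMeasure Ω) :=
  {Q | ∀ N, MeasurableSet N → IsPolar 𝓟 N → (Q : Measure Ω) N = 0}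

/-- `ca_c`: the finite signed measures `μ ≪ 𝓟`. -/
def ca (𝓟 : Set (ProbabilityMeasure Ω)) : Submodule ℝ (SignedMeasure Ω) where
  carrier := {μ | ∀ N, MeasurableSet N → IsPolar 𝓟 N → μ N = 0}
  add_mem' {μ ν} hμ hν N hN hp := by simp [hμ N hN hp, hν N hN hp]
  zero_mem' := by simp
  smul_mem' a μ hμ N hN hp := by simp [hμ N hN hp]

/-- `ca_{c+}`: the nonnegative elements of `ca_c`, i.e. the finite measures `μ ≪ 𝓟`. -/
def caPos (𝓟 : Set (ProbabilityMeasure Ω)) : Set (ca 𝓟) := {μ | 0 ≤ (μ : SignedMeasure Ω)}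

/-- A measure `μ` is supported if it has an order support `S`. -/
def IsSupported (𝓟 : Set (ProbabilityMeasure Ω)) (μ : Measure Ω) : Prop :=
  ∃ S, MeasurableSet S ∧ μ Sᶜ = 0 ∧
    ∀ N, MeasurableSet N → μ (N ∩ S) = 0 → IsPolar 𝓟 (N ∩ S)

/-- `sca_c`: the signed measures `μ ∈ ca_c` whose total variation `|μ|` is supported. -/
def sca (𝓟 : Set (ProbabilityMeasure Ω)) : Set (ca 𝓟) :=
  {μ | IsSupported 𝓟 (μ : SignedMeasure Ω).totalVariation}

/-- `sca_{c+}`. -/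
def scaPos (𝓟 : Set (ProbabilityMeasure Ω)) : Set (ca 𝓟) := sca 𝓟 ∩ caPos 𝓟

/-- The total variation of a nonnegative signed measure is that measure itself. -/
theorem totalVariation_toSignedMeasure (ν : Measure Ω) [IsFiniteMeasure ν] :
    ν.toSignedMeasure.totalVariation = ν := by
  let j : JordanDecomposition Ω :=
    { posPart := ν
      negPart := 0
      mutuallySingular := Measure.MutuallySingular.zero_right }
  have h : ν.toSignedMeasure = j.toSignedMeasure := by
    simp [j, JordanDecomposition.toSignedMeasure]
  rw [SignedMeasure.totalVariation, SignedMeasure.toJordanDecomposition_eq h]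
  simp [j]

theorem ca.jordan_null {𝓟 : Set (ProbabilityMeasure Ω)} (μ : ca 𝓟) {N : Set Ω}
    (hN : MeasurableSet N) (hp : IsPolar 𝓟 N) :
    (μ : SignedMeasure Ω).toJordanDecomposition.posPart N = 0 ∧
      (μ : SignedMeasure Ω).toJordanDecomposition.negPart N = 0 := by
  obtain ⟨i, hi, h1, h2, h3, h4⟩ := (μ : SignedMeasure Ω).toJordanDecomposition_spec
  have ha : (μ : SignedMeasure Ω) (i ∩ N) = 0 :=
    μ.2 _ (hi.inter hN) (hp.mono Set.inter_subset_right)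
  have hb : (μ : SignedMeasure Ω) (iᶜ ∩ N) = 0 :=
    μ.2 _ (hi.compl.inter hN) (hp.mono Set.inter_subset_right)
  rw [h3, h4, SignedMeasure.toMeasureOfZeroLE_apply _ _ hi hN,
    SignedMeasure.toMeasureOfLEZero_apply _ _ hi.compl hN]
  simp [ha, hb]

theorem ca.totalVariation_null {𝓟 : Set (ProbabilityMeasure Ω)} (μ : ca 𝓟) {N : Set Ω}
    (hN : MeasurableSet N) (hp : IsPolar 𝓟 N) :
    (μ : SignedMeasure Ω).totalVariation N = 0 := by
  simp [SignedMeasure.totalVariation, ca.jordan_null μ hN hp]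

theorem RV.measurableSet_ne (f g : RV Ω) :
    MeasurableSet {ω | (f : Ω → ℝ) ω ≠ (g : Ω → ℝ) ω} :=
  (measurableSet_eq_fun (RV.measurable f) (RV.measurable g)).compl

end Measures

section Integrals

/-- `E_Q[X] ∈ [0, ∞]` for `Q ∈ 𝔓_c(Ω)` and `X ∈ L⁰_{c+}`
(computed with the positive part of any representative of `X`). -/
noncomputable def expect {𝓟 : Set (ProbabilityMeasure Ω)} (Q : Pc 𝓟) (X : L0 𝓟) : ℝ≥0∞ :=
  L0.lift (fun f => ∫⁻ ω, ENNReal.ofReal ((f : Ω → ℝ) ω) ∂((Q : ProbabilityMeasure Ω) : Measure Ω))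
    (fun f g h => lintegral_congr_ae <| by
      have h0 : ∀ᵐ ω ∂((Q : ProbabilityMeasure Ω) : Measure Ω), (f : Ω → ℝ) ω = (g : Ω → ℝ) ω :=
        Q.2 _ (RV.measurableSet_ne f g) h
      filter_upwards [h0] with ω hω
      rw [hω]) X

/-- `∫ X dμ ∈ [0, ∞]` for `μ ∈ ca_{c+}` and `X ∈ L⁰_{c+}`; for such `μ` one has `|μ| = μ`
(computed with the positive part of any representative of `X`). -/
noncomputable def posIntegral {𝓟 : Set (ProbabilityMeasure Ω)} (μ : ca 𝓟) (X : L0 𝓟) : ℝ≥0∞ :=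
  L0.lift (fun f => ∫⁻ ω, ENNReal.ofReal ((f : Ω → ℝ) ω) ∂(μ : SignedMeasure Ω).totalVariation)
    (fun f g h => lintegral_congr_ae <| by
      have h0 : ∀ᵐ ω ∂(μ : SignedMeasure Ω).totalVariation, (f : Ω → ℝ) ω = (g : Ω → ℝ) ω :=
        ca.totalVariation_null μ (RV.measurableSet_ne f g) h
      filter_upwards [h0] with ω hω
      rw [hω]) X

/-- The pairing `∫ X dμ = ∫ X dμ⁺ - ∫ X dμ⁻` of `μ ∈ ca_c` with `X ∈ L^∞_c`. -/
noncomputable def pairing {𝓟 : Set (ProbabilityMeasure Ω)} (μ : ca 𝓟) (X : Linf 𝓟) : ℝ :=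
  L0.lift (fun f =>
      (∫ ω, (f : Ω → ℝ) ω ∂(μ : SignedMeasure Ω).toJordanDecomposition.posPart) -
        ∫ ω, (f : Ω → ℝ) ω ∂(μ : SignedMeasure Ω).toJordanDecomposition.negPart)
    (fun f g h => by
      have h1 : (f : Ω → ℝ) =ᵐ[(μ : SignedMeasure Ω).toJordanDecomposition.posPart] (g : Ω → ℝ) :=
        (ca.jordan_null μ (RV.measurableSet_ne f g) h).1
      have h2 : (f : Ω → ℝ) =ᵐ[(μ : SignedMeasure Ω).toJordanDecomposition.negPart] (g : Ω → ℝ) :=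
        (ca.jordan_null μ (RV.measurableSet_ne f g) h).2
      rw [integral_congr_ae h1, integral_congr_ae h2]) (X : L0 𝓟)

/-- For `M ⊆ ca_c`, the topology `σ(M, L^∞_c)` on `M`: the coarsest topology making
`μ ↦ ∫ X dμ` continuous for all `X ∈ L^∞_c`. -/
noncomputable abbrev weakTopology {𝓟 : Set (ProbabilityMeasure Ω)} (M : Set (ca 𝓟)) :
    TopologicalSpace M :=
  TopologicalSpace.induced (fun (μ : M) (X : Linf 𝓟) => pairing (μ : ca 𝓟) X)
    Pi.topologicalSpace

/-- `D` is closed in `M` for the topology `σ(M, L^∞_c)`. -/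
def IsWeaklyClosedIn {𝓟 : Set (ProbabilityMeasure Ω)} (M D : Set (ca 𝓟)) : Prop :=
  D ⊆ M ∧ IsClosed[weakTopology M] ((↑) ⁻¹' D : Set M)

/-- Solidness, within the set of measures `M`, of a set `D` of measures. -/
def IsSolidMeas {𝓟 : Set (ProbabilityMeasure Ω)} (M D : Set (ca 𝓟)) : Prop :=
  D ⊆ M ∧ ∀ μ ∈ D, ∀ ν ∈ M,
    (∀ A, MeasurableSet A → (ν : SignedMeasure Ω) A ≤ (μ : SignedMeasure Ω) A) → ν ∈ D

end Integrals

section Sets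

variable {𝓟 : Set (ProbabilityMeasure Ω)}

/-- The map `j_Q : L⁰_c → L⁰_Q`, `[f]_c ↦ [f]_Q`, for `Q ∈ 𝔓_c(Ω)`. -/
noncomputable def jQ (Q : Pc 𝓟) : L0 𝓟 → L0 {(Q : ProbabilityMeasure Ω)} :=
  L0.lift (fun f => L0.mk _ f) fun f g h => L0.mk_eq.2 <| isPolar_iff.2 <| by
    rintro _ rfl
    exact Q.2 _ (RV.measurableSet_ne f g) h

/-- `𝒬 ⊆ 𝔓_c(Ω)` is a reduction set for `C`. -/
def IsReductionSet (𝒬 : Set (Pc 𝓟)) (C : Set (L0 𝓟)) : Prop :=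
  𝒬.Nonempty ∧ C = ⋂ Q ∈ 𝒬, jQ Q ⁻¹' (jQ Q '' C)

/-- `𝓟`-sensitivity. -/
def IsSensitive (C : Set (L0 𝓟)) : Prop :=
  C = ⋂ Q : Pc 𝓟, jQ Q ⁻¹' (jQ Q '' C)

/-- Solidness in `L⁰_{c+}`. -/
def IsSolidPos (C : Set (L0 𝓟)) : Prop :=
  C ⊆ L0Pos 𝓟 ∧ ∀ X ∈ C, ∀ Y ∈ L0Pos 𝓟, Y ≤ X → Y ∈ C

/-- Order convergence of a sequence with respect to the `𝓟`-quasi-sure order. -/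
def OrderConverges (X : ℕ → L0 𝓟) (X₀ : L0 𝓟) : Prop :=
  ∃ Y : ℕ → L0 𝓟, Antitone Y ∧ IsGLB (Set.range Y) 0 ∧ ∀ n, |X n - X₀| ≤ Y n

/-- Sequential order closedness in `L⁰_c`. -/
def IsSeqOrderClosed (C : Set (L0 𝓟)) : Prop :=
  ∀ (X : ℕ → L0 𝓟) (X₀ : L0 𝓟), (∀ n, X n ∈ C) → OrderConverges X X₀ → X₀ ∈ C

/-- The polar `C° = {(Q, Z) ∈ 𝔓_c(Ω) × L^∞_{c+} | ∀ X ∈ C, E_Q[ZX] ≤ 1}`. -/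
def polar (C : Set (L0 𝓟)) : Set (Pc 𝓟 × L0 𝓟) :=
  {p | p.2 ∈ LinfPos 𝓟 ∧ ∀ X ∈ C, expect p.1 (p.2 * X) ≤ 1}

/-- The bipolar `C°°`. -/
def bipolar (C : Set (L0 𝓟)) : Set (L0 𝓟) :=
  {X | X ∈ L0Pos 𝓟 ∧ ∀ p ∈ polar C, expect p.1 (p.2 * X) ≤ 1}

/-- The polar `{μ ∈ M | ∀ X ∈ C, ∫ X dμ ≤ 1}` in a set `M` of measures. -/
def polarIn (M : Set (ca 𝓟)) (C : Set (L0 𝓟)) : Set (ca 𝓟) :=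
  {μ | μ ∈ M ∧ ∀ X ∈ C, posIntegral μ X ≤ 1}

/-- The bipolar `{X ∈ L⁰_{c+} | ∀ μ ∈ polar of C in M, ∫ X dμ ≤ 1}`. -/
def bipolarIn (M : Set (ca 𝓟)) (C : Set (L0 𝓟)) : Set (L0 𝓟) :=
  {X | X ∈ L0Pos 𝓟 ∧ ∀ μ ∈ polarIn M C, posIntegral μ X ≤ 1}

/-- `C°_{ca}`. -/
def polarCa (C : Set (L0 𝓟)) : Set (ca 𝓟) := polarIn (caPos 𝓟) C

/-- `C°°_{ca}`. -/
def bipolarCa (C : Set (L0 𝓟)) : Set (L0 𝓟) := bipolarIn (caPos 𝓟) C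

/-- `C°_{sca}`. -/
def polarSca (C : Set (L0 𝓟)) : Set (ca 𝓟) := polarIn (scaPos 𝓟) C

/-- `C°°_{sca}`. -/
def bipolarSca (C : Set (L0 𝓟)) : Set (L0 𝓟) := bipolarIn (scaPos 𝓟) C

end Sets

end RobustModel

open RobustModel

/-! A positive element of `ca_c` is an ordinary finite measure `m` that is null on polar events
(`exists_eq_caOf`), so the bipolar in `ca_c` is cut out by constraints `∫ X dm ≤ 1`. A pair `(Q, Z)`
is such a measure, namely `Z dQ`, and conversely a nonzero `m` is `r Q` with `r` constant; this
identifies the two bipolars.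

Each constraint is convex and monotone in `X ≥ 0`, survives order limits by Fatou (order convergence
implies almost sure convergence under every dominated measure), and sees `X` only through `j_Q X`
for a single `Q`. Hence bipolars are convex, solid, sequentially order closed and sensitive.

For the converse, sensitivity or a reduction set provides a `Q` with `j_Q X ∉ j_Q C`, which leaves a
problem under one probability. Truncations of `X` reduce it to `L²(Q)`, where the trace of `C` is
convex and closed (`isClosed_l2Trace`). Hilbert space projection separates, and solidity allows the
separating function to be replaced by its positive part (`exists_nonneg_separating`). The resulting
`z dQ` lies in the polar (`exists_density_separating`); it is supported whenever `Q` is, which gives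
the version for `sca_c`.

The polars are weakly closed because membership amounts to inequalities between pairings with
bounded functions: indicators for positivity, truncations for the bounds (`mem_polarCa_iff`). -/

namespace RobustModel

variable {Ω : Type*} [MeasurableSpace Ω] {𝓟 : Set (ProbabilityMeasure Ω)}

/-! ### Quasi-sure relations through representatives and dominated measures. -/

section QuasiSure

theorem L0.mk_le_iff {f g : RV Ω} : L0.mk 𝓟 f ≤ L0.mk 𝓟 g ↔
    ∀ P ∈ 𝓟, ∀ᵐ ω ∂(P : Measure Ω), (f : Ω → ℝ) ω ≤ (g : Ω → ℝ) ω := by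
  simp [L0.mk_le, isPolar_iff, ae_iff]

theorem L0.mk_eq_iff {f g : RV Ω} : L0.mk 𝓟 f = L0.mk 𝓟 g ↔
    ∀ P ∈ 𝓟, ∀ᵐ ω ∂(P : Measure Ω), (f : Ω → ℝ) ω = (g : Ω → ℝ) ω := by
  simp [L0.mk_eq, isPolar_iff, ae_iff]

theorem L0.mk_mem_L0Pos {f : RV Ω} : L0.mk 𝓟 f ∈ L0Pos 𝓟 ↔
    ∀ P ∈ 𝓟, ∀ᵐ ω ∂(P : Measure Ω), 0 ≤ (f : Ω → ℝ) ω :=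
  L0.mk_le_iff (f := 0)

theorem L0.mk_sub (f g : RV Ω) : L0.mk 𝓟 (f - g) = L0.mk 𝓟 f - L0.mk 𝓟 g := rfl

theorem L0.mk_mul (f g : RV Ω) : L0.mk 𝓟 (f * g) = L0.mk 𝓟 f * L0.mk 𝓟 g := rfl

theorem L0.mk_algebraMap (a : ℝ) :
    L0.mk 𝓟 (algebraMap ℝ (RV Ω) a) = algebraMap ℝ (L0 𝓟) a := rfl

theorem L0.abs_mk (f : RV Ω) : |L0.mk 𝓟 f| = L0.mk 𝓟 (RV.max f (-f)) := rfl

/-- The measures that vanish on all polar events. -/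
def IsDominated (𝓟 : Set (ProbabilityMeasure Ω)) (m : Measure Ω) : Prop :=
  ∀ N, MeasurableSet N → IsPolar 𝓟 N → m N = 0

theorem IsDominated.ae {m : Measure Ω} (hm : IsDominated 𝓟 m) {p : Ω → Prop}
    (hp : MeasurableSet {ω | p ω}) (h : ∀ P ∈ 𝓟, ∀ᵐ ω ∂(P : Measure Ω), p ω) :
    ∀ᵐ ω ∂m, p ω :=
  hm _ hp.compl (isPolar_iff.2 h)

theorem IsDominated.ae_le {m : Measure Ω} (hm : IsDominated 𝓟 m) {f g : RV Ω}
    (h : L0.mk 𝓟 f ≤ L0.mk 𝓟 g) : ∀ᵐ ω ∂m, (f : Ω → ℝ) ω ≤ (g : Ω → ℝ) ω :=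
  hm.ae (measurableSet_le (RV.measurable f) (RV.measurable g)) (L0.mk_le_iff.1 h)

theorem IsDominated.ae_nonneg {m : Measure Ω} (hm : IsDominated 𝓟 m) {f : RV Ω}
    (h : L0.mk 𝓟 f ∈ L0Pos 𝓟) : ∀ᵐ ω ∂m, 0 ≤ (f : Ω → ℝ) ω :=
  hm.ae_le (f := 0) h

theorem Pc.isDominated (Q : Pc 𝓟) : IsDominated 𝓟 ((Q : ProbabilityMeasure Ω) : Measure Ω) := Q.2

theorem isDominated_of_mem {P : ProbabilityMeasure Ω} (hP : P ∈ 𝓟) :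
    IsDominated 𝓟 (P : Measure Ω) := fun _ _ h => isPolar_iff.1 h P hP

theorem IsDominated.smul {m : Measure Ω} (hm : IsDominated 𝓟 m) (a : ℝ≥0∞) :
    IsDominated 𝓟 (a • m) := fun N hN hp => by simp [hm N hN hp]

theorem IsDominated.add {m n : Measure Ω} (hm : IsDominated 𝓟 m) (hn : IsDominated 𝓟 n) :
    IsDominated 𝓟 (m + n) := fun N hN hp => by simp [hm N hN hp, hn N hN hp]

theorem IsDominated.withDensity {m : Measure Ω} (hm : IsDominated 𝓟 m) (z : Ω → ℝ≥0∞) :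
    IsDominated 𝓟 (m.withDensity z) := fun N hN hp =>
  withDensity_absolutelyContinuous m z (hm N hN hp)

theorem jQ_mk (Q : Pc 𝓟) (f : RV Ω) : jQ Q (L0.mk 𝓟 f) = L0.mk _ f := rfl

theorem jQ_mk_eq_iff {Q : Pc 𝓟} {f g : RV Ω} : jQ Q (L0.mk 𝓟 f) = jQ Q (L0.mk 𝓟 g) ↔
    (f : Ω → ℝ) =ᵐ[((Q : ProbabilityMeasure Ω) : Measure Ω)] (g : Ω → ℝ) := by
  simp [jQ_mk, L0.mk_eq_iff, Filter.EventuallyEq]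

end QuasiSure

/-! ### Positive elements of `ca_c` as finite measures, and equality of the two bipolars. -/

section PositiveMeasures

/-- A dominated finite measure as an element of `ca_c`. -/
noncomputable def caOf (m : Measure Ω) [IsFiniteMeasure m] (hm : IsDominated 𝓟 m) : ca 𝓟 :=
  ⟨m.toSignedMeasure, fun N hN hp => by
    simp [Measure.toSignedMeasure_apply_measurable hN, measureReal_def, hm N hN hp]⟩

theorem totalVariation_caOf (m : Measure Ω) [IsFiniteMeasure m] (hm : IsDominated 𝓟 m) :
    (caOf m hm : SignedMeasure Ω).totalVariation = m :=
  totalVariation_toSignedMeasure m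

theorem caOf_apply (m : Measure Ω) [IsFiniteMeasure m] (hm : IsDominated 𝓟 m) {A : Set Ω}
    (hA : MeasurableSet A) : (caOf m hm : SignedMeasure Ω) A = m.real A :=
  Measure.toSignedMeasure_apply_measurable hA

theorem caOf_mem_caPos (m : Measure Ω) [IsFiniteMeasure m] (hm : IsDominated 𝓟 m) :
    caOf m hm ∈ caPos 𝓟 :=
  Measure.zero_le_toSignedMeasure m

/-- Allows signed measures, total variations and Jordan decompositions to be replaced by ordinary
measures whenever positivity is known. -/
theorem exists_eq_caOf {μ : ca 𝓟} (hμ : μ ∈ caPos 𝓟) :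
    ∃ (m : Measure Ω) (_ : IsFiniteMeasure m) (hm : IsDominated 𝓟 m), μ = caOf m hm := by
  have h0 : 0 ≤[Set.univ] (μ : SignedMeasure Ω) := by
    rw [VectorMeasure.le_restrict_univ_iff_le]; exact hμ
  have key : ((μ : SignedMeasure Ω).toMeasureOfZeroLE _ .univ h0).toSignedMeasure
      = (μ : SignedMeasure Ω) := SignedMeasure.toMeasureOfZeroLE_toSignedMeasure _ h0
  refine ⟨_, SignedMeasure.toMeasureOfZeroLE_finite _ h0 .univ, fun N hN hp => ?_,
    Subtype.ext key.symm⟩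
  rw [SignedMeasure.toMeasureOfZeroLE_apply _ _ _ hN]
  simp [μ.2 N hN hp]

theorem posIntegral_caOf (m : Measure Ω) [IsFiniteMeasure m] (hm : IsDominated 𝓟 m) (f : RV Ω) :
    posIntegral (caOf m hm) (L0.mk 𝓟 f) = ∫⁻ ω, ENNReal.ofReal ((f : Ω → ℝ) ω) ∂m := by
  change ∫⁻ ω, ENNReal.ofReal ((f : Ω → ℝ) ω) ∂(caOf m hm : SignedMeasure Ω).totalVariation = _
  rw [totalVariation_caOf]

theorem caOf_mem_sca_iff (m : Measure Ω) [IsFiniteMeasure m] (hm : IsDominated 𝓟 m) :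
    caOf m hm ∈ sca 𝓟 ↔ IsSupported 𝓟 m := by
  change IsSupported 𝓟 _ ↔ _
  rw [totalVariation_caOf]

theorem expect_mk (Q : Pc 𝓟) (f : RV Ω) : expect Q (L0.mk 𝓟 f) =
    ∫⁻ ω, ENNReal.ofReal ((f : Ω → ℝ) ω) ∂((Q : ProbabilityMeasure Ω) : Measure Ω) := rfl

/-- A nonzero dominated finite measure is a multiple of some `Q ∈ 𝔓_c`. -/
theorem IsDominated.exists_eq_smul {m : Measure Ω} [IsFiniteMeasure m] (hm : IsDominated 𝓟 m)
    (h0 : m ≠ 0) : ∃ (Q : Pc 𝓟) (r : ℝ), 0 < r ∧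
      m = ENNReal.ofReal r • ((Q : ProbabilityMeasure Ω) : Measure Ω) := by
  have : NeZero m := ⟨h0⟩
  have hu : m Set.univ ≠ 0 := by simpa using h0
  have hu' : m Set.univ ≠ ∞ := measure_ne_top _ _
  refine ⟨⟨⟨(m Set.univ)⁻¹ • m, by infer_instance⟩, hm.smul _⟩, m.real Set.univ, ?_, ?_⟩
  · simpa [measureReal_def] using ENNReal.toReal_pos hu hu'
  · change m = _ • ((m Set.univ)⁻¹ • m)
    rw [smul_smul, measureReal_def, ENNReal.ofReal_toReal hu', ENNReal.mul_inv_cancel hu hu',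
      one_smul]

/-- Positivity of `z` holds `Q`-almost surely, so `ENNReal.ofReal` splits over the product. This is
the passage from the pair `(Q, Z)` to the measure `Z dQ`. -/
theorem expect_mul {Q : Pc 𝓟} {z : RV Ω} (hz : L0.mk 𝓟 z ∈ L0Pos 𝓟) (f : RV Ω) :
    expect Q (L0.mk 𝓟 z * L0.mk 𝓟 f) = ∫⁻ ω, ENNReal.ofReal ((f : Ω → ℝ) ω)
      ∂((Q : ProbabilityMeasure Ω) : Measure Ω).withDensity
        fun ω => ENNReal.ofReal ((z : Ω → ℝ) ω) := by
  rw [lintegral_withDensity_eq_lintegral_mul _ (RV.measurable z).ennreal_ofReal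
    (RV.measurable f).ennreal_ofReal, ← L0.mk_mul, expect_mk]
  refine lintegral_congr_ae ?_
  filter_upwards [(Pc.isDominated Q).ae_nonneg hz] with ω hω
  exact ENNReal.ofReal_mul hω

theorem isFiniteMeasure_withDensity_Linf (Q : Pc 𝓟) {z : RV Ω} (hz : L0.mk 𝓟 z ∈ Linf 𝓟) :
    IsFiniteMeasure (((Q : ProbabilityMeasure Ω) : Measure Ω).withDensity
      fun ω => ENNReal.ofReal ((z : Ω → ℝ) ω)) := by
  obtain ⟨M, -, hM⟩ := hz
  rw [L0.abs_mk, ← L0.mk_algebraMap] at hM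
  refine isFiniteMeasure_withDensity (ne_of_lt ?_)
  calc _ ≤ ∫⁻ _, ENNReal.ofReal M ∂((Q : ProbabilityMeasure Ω) : Measure Ω) := by
        refine lintegral_mono_ae ?_
        filter_upwards [(Pc.isDominated Q).ae_le hM] with ω hω
        exact ENNReal.ofReal_le_ofReal ((le_max_left _ _).trans hω)
    _ < ∞ := by simp

/-- The two polars induce the same functionals on representatives: `Z dQ` in one direction,
normalisation of `m` with constant `Z` in the other. -/
theorem bipolarCa_eq_bipolar (C : Set (L0 𝓟)) : bipolarCa C = bipolar C := by
  ext X
  induction X using L0.ind with | h x => ?_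
  refine and_congr_right fun _ => ⟨?_, ?_⟩
  · rintro h ⟨Q, Z⟩ ⟨⟨hb, hz⟩, hp⟩
    induction Z using L0.ind with | h z => ?_
    have := isFiniteMeasure_withDensity_Linf Q hb
    have key : ∀ f : RV Ω, posIntegral (caOf _ ((Pc.isDominated Q).withDensity
        fun ω => ENNReal.ofReal ((z : Ω → ℝ) ω))) (L0.mk 𝓟 f) =
        expect Q (L0.mk 𝓟 z * L0.mk 𝓟 f) := fun f => by
      rw [posIntegral_caOf, expect_mul hz]
    have := h _ ⟨caOf_mem_caPos _ ((Pc.isDominated Q).withDensity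
        fun ω => ENNReal.ofReal ((z : Ω → ℝ) ω)), fun Y hY => by
      induction Y using L0.ind with | h y => ?_
      rw [key]
      exact hp _ hY⟩
    rwa [key] at this
  · rintro h μ ⟨hμ, hp⟩
    obtain ⟨m, _, hm, rfl⟩ := exists_eq_caOf hμ
    -- The zero measure cannot be normalised, but its constraint is vacuous.
    by_cases h0 : m = 0
    · subst h0
      simp [posIntegral_caOf]
    obtain ⟨Q, r, hr, hQ⟩ := hm.exists_eq_smul h0
    have hpos : L0.mk 𝓟 (algebraMap ℝ (RV Ω) r) ∈ L0Pos 𝓟 :=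
      L0.mk_mem_L0Pos.2 fun P _ => ae_of_all _ fun _ => hr.le
    have hb : L0.mk 𝓟 (algebraMap ℝ (RV Ω) r) ∈ Linf 𝓟 :=
      ⟨r, hr, (L0.mk_le_iff.2 fun P _ => ae_of_all _ fun _ =>
        max_le le_rfl (by change -r ≤ r; linarith))⟩
    have key : ∀ f : RV Ω, posIntegral (caOf m hm) (L0.mk 𝓟 f) =
        expect Q (L0.mk 𝓟 (algebraMap ℝ (RV Ω) r) * L0.mk 𝓟 f) := fun f => by
      rw [posIntegral_caOf, expect_mul hpos, hQ]
      congr 1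
      exact (withDensity_const _).symm
    rw [key]
    refine h (Q, L0.mk 𝓟 (algebraMap ℝ (RV Ω) r)) ⟨⟨hb, hpos⟩, fun Y hY => ?_⟩
    induction Y using L0.ind with | h y => ?_
    exact (key y).symm.trans_le (hp _ hY)

end PositiveMeasures

/-! ### Order convergence versus pointwise convergence, truncation and restriction. -/

section OrderConvergence

open Filter (Tendsto Eventually atTop liminf liminf_le_liminf liminf_const eventually_ge_atTop)

/-- Everywhere pointwise convergence implies order convergence. -/
theorem orderConverges_of_tendsto {f : ℕ → RV Ω} {g : RV Ω}
    (h : ∀ ω, Tendsto (fun n => (f n : Ω → ℝ) ω) atTop (𝓝 ((g : Ω → ℝ) ω))) :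
    OrderConverges (fun n => L0.mk 𝓟 (f n)) (L0.mk 𝓟 g) := by
  have hd : ∀ ω, Tendsto (fun n => |(f n : Ω → ℝ) ω - (g : Ω → ℝ) ω|) atTop (𝓝 0) := fun ω => by
    simpa using ((h ω).sub_const ((g : Ω → ℝ) ω)).abs
  have hb : ∀ ω n, BddAbove (Set.range fun m => |(f (m + n) : Ω → ℝ) ω - (g : Ω → ℝ) ω|) :=
    fun ω n => (hd ω).bddAbove_range.mono (by rintro _ ⟨m, rfl⟩; exact ⟨m + n, rfl⟩)
  -- The dominating sequence consists of tail suprema, finite because convergent sequences are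
  -- bounded.
  let y : ℕ → RV Ω := fun n => ⟨fun ω => ⨆ m, |(f (m + n) : Ω → ℝ) ω - (g : Ω → ℝ) ω|,
    Measurable.iSup fun m => ((RV.measurable _).sub (RV.measurable g)).abs⟩
  have hle : ∀ ω n m, n ≤ m → |(f m : Ω → ℝ) ω - (g : Ω → ℝ) ω| ≤ (y n : Ω → ℝ) ω := by
    intro ω n m hnm
    have := le_ciSup (hb ω n) (m - n)
    simpa [Nat.sub_add_cancel hnm] using this
  refine ⟨fun n => L0.mk 𝓟 (y n), fun n m hnm => ?_, ⟨?_, fun Z hZ => ?_⟩, fun n => ?_⟩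
  · exact L0.mk_le_iff.2 fun P _ => ae_of_all _ fun ω =>
      ciSup_le fun k => hle ω n (k + m) (by omega)
  · rintro _ ⟨n, rfl⟩
    exact L0.mk_mem_L0Pos.2 fun P _ => ae_of_all _ fun ω =>
      (abs_nonneg _).trans (hle ω n n le_rfl)
  · induction Z using L0.ind with | h z => ?_
    refine (L0.mk_le_iff (g := 0)).2 fun P hP => ?_
    have hz : ∀ᵐ ω ∂(P : Measure Ω), ∀ n, (z : Ω → ℝ) ω ≤ (y n : Ω → ℝ) ω :=
      ae_all_iff.2 fun n => L0.mk_le_iff.1 (hZ ⟨n, rfl⟩) P hP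
    filter_upwards [hz] with ω hω
    refine le_of_forall_pos_le_add fun ε hε => ?_
    obtain ⟨n, hn⟩ := ((hd ω).eventually_le_const hε).exists_forall_of_atTop
    refine (hω n).trans ((ciSup_le fun k => hn _ (by omega)).trans (zero_add ε).ge)
  · rw [← L0.mk_sub, L0.abs_mk]
    exact L0.mk_le_iff.2 fun P _ => ae_of_all _ fun ω => hle ω n n le_rfl

/-- Order convergence implies quasi-sure pointwise convergence. -/
theorem OrderConverges.ae_tendsto {f : ℕ → RV Ω} {g : RV Ω}
    (h : OrderConverges (fun n => L0.mk 𝓟 (f n)) (L0.mk 𝓟 g)) {m : Measure Ω}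
    (hm : IsDominated 𝓟 m) :
    ∀ᵐ ω ∂m, Tendsto (fun n => (f n : Ω → ℝ) ω) atTop (𝓝 ((g : Ω → ℝ) ω)) := by
  obtain ⟨Y, hY, hglb, hle⟩ := h
  have hex : ∀ n, ∃ y : RV Ω, L0.mk 𝓟 y = Y n := fun n => by
    induction Y n using L0.ind with | h y => exact ⟨y, rfl⟩
  choose y hy using hex
  obtain rfl : (fun n => L0.mk 𝓟 (y n)) = Y := funext hy
  have hbdd : ∀ ω, BddBelow (Set.range fun n => (y n : Ω → ℝ) ω ⊔ 0) := fun ω =>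
    ⟨0, by rintro _ ⟨n, rfl⟩; exact le_max_right _ _⟩
  -- The pointwise infimum is a lower bound of the sequence in `L⁰_c`, hence quasi-surely at most
  -- zero. Cutting at `0` keeps the real infimum bounded below at every point, not only off a polar
  -- event.
  let z : RV Ω := ⟨fun ω => ⨅ n, ((y n : Ω → ℝ) ω ⊔ 0),
    Measurable.iInf fun n => (RV.measurable (y n)).sup measurable_const⟩
  have hpos : ∀ n, L0.mk 𝓟 (y n) ∈ L0Pos 𝓟 := fun n => hglb.1 ⟨n, rfl⟩
  have hz : L0.mk 𝓟 z ≤ L0.mk 𝓟 0 := hglb.2 <| by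
    rintro _ ⟨n, rfl⟩
    refine L0.mk_le_iff.2 fun P hP => ?_
    filter_upwards [L0.mk_mem_L0Pos.1 (hpos n) P hP] with ω hω
    exact (ciInf_le (hbdd ω) n).trans (max_le le_rfl hω)
  have h1 : ∀ᵐ ω ∂m, ∀ n, (y (n + 1) : Ω → ℝ) ω ≤ (y n : Ω → ℝ) ω :=
    ae_all_iff.2 fun n => hm.ae_le (hY n.le_succ)
  have h2 : ∀ᵐ ω ∂m, ∀ n, (RV.max (f n - g) (-(f n - g)) : Ω → ℝ) ω ≤ (y n : Ω → ℝ) ω :=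
    ae_all_iff.2 fun n => hm.ae_le (hle n)
  have h3 : ∀ᵐ ω ∂m, ∀ n, 0 ≤ (y n : Ω → ℝ) ω := ae_all_iff.2 fun n => hm.ae_nonneg (hpos n)
  filter_upwards [h1, h2, h3, hm.ae_le hz] with ω h1 h2 h3 h4
  have hanti : Antitone fun n => (y n : Ω → ℝ) ω := antitone_nat_of_succ_le h1
  have hlim := tendsto_atTop_ciInf hanti ⟨0, by rintro _ ⟨n, rfl⟩; exact h3 n⟩
  have h0 : ⨅ n, (y n : Ω → ℝ) ω = 0 := by
    refine le_antisymm (le_of_eq_of_le ?_ h4) (le_ciInf h3)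
    exact iInf_congr fun n => (max_eq_left (h3 n)).symm
  rw [h0] at hlim
  rw [tendsto_iff_dist_tendsto_zero]
  exact squeeze_zero (fun _ => dist_nonneg) (fun n => h2 n) hlim

/-- A closed sublevel property of positive integrals, by Fatou's lemma. -/
theorem lintegral_ofReal_le_of_tendsto {m : Measure Ω} {f : ℕ → RV Ω} {g : RV Ω} {a : ℝ≥0∞}
    (h : ∀ᵐ ω ∂m, Tendsto (fun n => (f n : Ω → ℝ) ω) atTop (𝓝 ((g : Ω → ℝ) ω)))
    (hf : ∀ n, ∫⁻ ω, ENNReal.ofReal ((f n : Ω → ℝ) ω) ∂m ≤ a) :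
    ∫⁻ ω, ENNReal.ofReal ((g : Ω → ℝ) ω) ∂m ≤ a := by
  calc _ = ∫⁻ ω, liminf (fun n => ENNReal.ofReal ((f n : Ω → ℝ) ω)) atTop ∂m := by
        refine lintegral_congr_ae ?_
        filter_upwards [h] with ω hω
        exact ((ENNReal.continuous_ofReal.tendsto _).comp hω).liminf_eq.symm
    _ ≤ liminf (fun n => ∫⁻ ω, ENNReal.ofReal ((f n : Ω → ℝ) ω) ∂m) atTop :=
        lintegral_liminf_le fun n => (RV.measurable _).ennreal_ofReal
    _ ≤ a := (liminf_le_liminf (Eventually.of_forall hf)).trans_eq (liminf_const a)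

/-- Restriction of a random variable to a measurable set. -/
noncomputable def RV.restrict (f : RV Ω) {A : Set Ω} (hA : MeasurableSet A) : RV Ω :=
  ⟨A.indicator f, (RV.measurable f).indicator hA⟩

/-- Truncation of a random variable from above. -/
noncomputable def RV.trunc (f : RV Ω) (n : ℕ) : RV Ω := RV.min f (algebraMap ℝ (RV Ω) n)

theorem RV.trunc_apply (f : RV Ω) (n : ℕ) (ω : Ω) :
    (RV.trunc f n : Ω → ℝ) ω = (f : Ω → ℝ) ω ⊓ (n : ℝ) := rfl

theorem RV.tendsto_trunc (f : RV Ω) (ω : Ω) :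
    Tendsto (fun n => (RV.trunc f n : Ω → ℝ) ω) atTop (𝓝 ((f : Ω → ℝ) ω)) := by
  obtain ⟨N, hN⟩ := exists_nat_ge ((f : Ω → ℝ) ω)
  refine tendsto_const_nhds.congr' ?_
  filter_upwards [eventually_ge_atTop N] with n hn
  exact (min_eq_left (hN.trans (Nat.cast_le.2 hn))).symm

theorem RV.mk_trunc_mem_L0Pos {f : RV Ω} (hf : L0.mk 𝓟 f ∈ L0Pos 𝓟) (n : ℕ) :
    L0.mk 𝓟 (RV.trunc f n) ∈ L0Pos 𝓟 := by
  refine L0.mk_mem_L0Pos.2 fun P hP => ?_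
  filter_upwards [L0.mk_mem_L0Pos.1 hf P hP] with ω hω
  exact le_min hω n.cast_nonneg

theorem IsSolidPos.restrict_mem {C : Set (L0 𝓟)} (hC : IsSolidPos C) {f : RV Ω}
    (hf : L0.mk 𝓟 f ∈ C) {A : Set Ω} (hA : MeasurableSet A) :
    L0.mk 𝓟 (RV.restrict f hA) ∈ C := by
  refine hC.2 _ hf _ (L0.mk_mem_L0Pos.2 fun P hP => ?_) (L0.mk_le_iff.2 fun P hP => ?_)
  · filter_upwards [L0.mk_mem_L0Pos.1 (hC.1 hf) P hP] with ω hω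
    exact Set.indicator_apply_nonneg fun _ => hω
  · filter_upwards [L0.mk_mem_L0Pos.1 (hC.1 hf) P hP] with ω hω
    exact Set.indicator_apply_le' (fun _ => le_rfl) fun _ => hω

theorem IsSolidPos.trunc_mem {C : Set (L0 𝓟)} (hC : IsSolidPos C) {f : RV Ω}
    (hf : L0.mk 𝓟 f ∈ C) (n : ℕ) : L0.mk 𝓟 (RV.trunc f n) ∈ C :=
  hC.2 _ hf _ (RV.mk_trunc_mem_L0Pos (hC.1 hf) n)
    (L0.mk_le_iff.2 fun _ _ => ae_of_all _ fun _ => min_le_left _ _)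

theorem IsSolidPos.zero_mem {C : Set (L0 𝓟)} (hC : IsSolidPos C) (hne : C.Nonempty) :
    L0.mk 𝓟 0 ∈ C := by
  obtain ⟨X, hX⟩ := hne
  exact hC.2 X hX _ (L0.mk_mem_L0Pos.2 fun _ _ => ae_of_all _ fun _ => le_rfl) (hC.1 hX)

/-- Solid and sequentially order closed sets are closed for almost sure limits. -/
theorem exists_mem_ae_eq_of_tendsto {C : Set (L0 𝓟)} (hsol : IsSolidPos C)
    (hcl : IsSeqOrderClosed C) {m : Measure Ω} {c : ℕ → RV Ω} {x : RV Ω}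
    (hc : ∀ n, L0.mk 𝓟 (c n) ∈ C)
    (hlim : ∀ᵐ ω ∂m, Tendsto (fun n => (c n : Ω → ℝ) ω) atTop (𝓝 ((x : Ω → ℝ) ω))) :
    ∃ y : RV Ω, L0.mk 𝓟 y ∈ C ∧ (y : Ω → ℝ) =ᵐ[m] (x : Ω → ℝ) := by
  obtain ⟨N, hN, hNm, hN0⟩ := exists_measurable_superset_of_null (ae_iff.1 hlim)
  -- The `m`-null event `N` need not be polar. Setting everything to zero on `N` stays in `C` by
  -- solidity and makes the convergence hold everywhere, hence in order.
  refine ⟨RV.restrict x hNm.compl, hcl _ _ (fun n => hsol.restrict_mem (hc n) hNm.compl)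
    (orderConverges_of_tendsto fun ω => ?_), ?_⟩
  · by_cases hω : ω ∈ N
    · simp [RV.restrict, hω]
    · have : Tendsto (fun n => (c n : Ω → ℝ) ω) atTop (𝓝 ((x : Ω → ℝ) ω)) :=
        not_not.1 fun h => hω (hN h)
      simpa [RV.restrict, hω] using this
  · filter_upwards [compl_mem_ae_iff.2 hN0] with ω hω
    exact Set.indicator_of_mem hω _

end OrderConvergence

/-! ### Separation under a single probability measure, in `L²`. -/

section Separation

open Filter (Tendsto Eventually atTop)

/-- Square-integrable functions that agree `m`-a.e. with an element of `C`. -/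
def l2Trace (C : Set (L0 𝓟)) (m : Measure Ω) : Set (Lp ℝ 2 m) :=
  {F | ∃ c : RV Ω, L0.mk 𝓟 c ∈ C ∧ F =ᵐ[m] (c : Ω → ℝ)}

theorem convex_l2Trace {C : Set (L0 𝓟)} (hconv : Convex ℝ C) (m : Measure Ω) :
    Convex ℝ (l2Trace C m) := by
  rintro F ⟨c, hc, hF⟩ G ⟨d, hd, hG⟩ a b ha hb hab
  refine ⟨a • c + b • d, hconv hc hd ha hb hab, ?_⟩
  filter_upwards [hF, hG, Lp.coeFn_add (a • F) (b • G), Lp.coeFn_smul a F, Lp.coeFn_smul b G]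
    with ω h1 h2 h3 h4 h5
  rw [h3, Pi.add_apply, h4, h5, Pi.smul_apply, Pi.smul_apply, h1, h2]
  rfl

theorem isClosed_l2Trace {C : Set (L0 𝓟)} (hsol : IsSolidPos C) (hcl : IsSeqOrderClosed C)
    (m : Measure Ω) : IsClosed (l2Trace C m) := by
  refine IsSeqClosed.isClosed fun F G hF hlim => ?_
  choose c hc hFc using hF
  -- An almost surely convergent subsequence suffices for closedness under almost sure limits.
  obtain ⟨ns, -, hns⟩ := (tendstoInMeasure_of_tendsto_Lp hlim).exists_seq_tendsto_ae
  let g : RV Ω := ⟨G,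
    (Lp.stronglyMeasurable G).measurable⟩
  obtain ⟨y, hy, hyg⟩ := exists_mem_ae_eq_of_tendsto (m := m) (c := fun i => c (ns i)) (x := g)
    hsol hcl (fun i => hc _) (by
      filter_upwards [hns, ae_all_iff.2 fun n => hFc n] with ω h1 h2
      exact h1.congr fun i => h2 _)
  exact ⟨y, hy, hyg.symm⟩

theorem restrict_mem_l2Trace {C : Set (L0 𝓟)} (hsol : IsSolidPos C) {m : Measure Ω}
    {F : Lp ℝ 2 m} (hF : F ∈ l2Trace C m) {A : Set Ω} (hA : MeasurableSet A) :
    ((Lp.memLp F).indicator hA).toLp _ ∈ l2Trace C m := by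
  obtain ⟨c, hc, hFc⟩ := hF
  refine ⟨RV.restrict c hA, hsol.restrict_mem hc hA, ?_⟩
  filter_upwards [hFc, ((Lp.memLp F).indicator hA).coeFn_toLp] with ω h1 h2
  simp [h2, RV.restrict, Set.indicator, h1]

/-- Separation of a nonnegative square-integrable function from `l2Trace C m` by a nonnegative
square-integrable function. -/
theorem exists_nonneg_separating {C : Set (L0 𝓟)} (hne : C.Nonempty) (hconv : Convex ℝ C)
    (hsol : IsSolidPos C) (hcl : IsSeqOrderClosed C) {m : Measure Ω} {F : Lp ℝ 2 m}
    (hF0 : 0 ≤ᵐ[m] F) (hF : F ∉ l2Trace C m) :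
    ∃ z : Ω → ℝ, Measurable z ∧ MemLp z 2 m ∧ (∀ ω, 0 ≤ z ω) ∧
      (∀ W ∈ l2Trace C m, ∫ ω, z ω * W ω ∂m ≤ 1) ∧ 1 < ∫ ω, z ω * F ω ∂m := by
  have h0 : (0 : Lp ℝ 2 m) ∈ l2Trace C m := ⟨0, hsol.zero_mem hne, Lp.coeFn_zero _ _ _⟩
  have hcK := convex_l2Trace hconv m
  -- `V` is the projection of `F` on the trace; the variational inequality for `Z = F - V` makes `V`
  -- maximise `⟨Z, ·⟩` there, with value `α`.
  obtain ⟨V, hV, hmin⟩ := exists_norm_eq_iInf_of_complete_convex ⟨0, h0⟩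
    (isClosed_l2Trace hsol hcl m).isComplete hcK F
  have hle := (norm_eq_iInf_iff_real_inner_le_zero hcK hV).1 hmin
  set Z := F - V
  have hZ0 : Z ≠ 0 := fun h => hF ((sub_eq_zero.1 h : F = V) ▸ hV)
  set α := inner ℝ Z V
  have hα : 0 ≤ α := by simpa using hle 0 h0
  have hαW : ∀ W ∈ l2Trace C m, inner ℝ Z W ≤ α := fun W hW => by
    have := hle W hW; rw [inner_sub_right] at this; linarith
  have hαF : α < inner ℝ Z F := by
    have : 0 < inner ℝ Z Z := real_inner_self_pos.2 hZ0
    rw [show inner ℝ Z Z = inner ℝ Z F - α by rw [← inner_sub_right]] at this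
    linarith
  have hZm : Measurable Z := (Lp.stronglyMeasurable Z).measurable
  have hA : MeasurableSet {ω | 0 < Z ω} := measurableSet_lt measurable_const hZm
  have hinner : ∀ W : Lp ℝ 2 m, inner ℝ Z W = ∫ ω, Z ω * W ω ∂m := fun W => by
    rw [L2.inner_def]; simp [mul_comm]
  have hzp : MemLp (fun ω => max (Z ω) 0) 2 m := (Lp.memLp Z).pos_part
  -- Pairing `Z⁺` with `W` is pairing `Z` with `W` restricted to `{Z > 0}`, which stays in the trace
  -- by solidity.
  have hW' : ∀ W ∈ l2Trace C m, ∫ ω, max (Z ω) 0 * W ω ∂m ≤ α := fun W hW => by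
    refine le_of_eq_of_le ?_ (hαW _ (restrict_mem_l2Trace hsol hW hA))
    rw [hinner]
    refine integral_congr_ae ?_
    filter_upwards [((Lp.memLp W).indicator hA).coeFn_toLp] with ω h
    rw [h]
    by_cases hω : 0 < Z ω
    · simp [hω, hω.le]
    · simp [hω, not_lt.1 hω]
  have hF' : α < ∫ ω, max (Z ω) 0 * F ω ∂m := by
    refine hαF.trans_le ?_
    rw [hinner]
    refine integral_mono_ae ((Lp.memLp Z).integrable_mul (Lp.memLp F))
      (hzp.integrable_mul (Lp.memLp F)) ?_
    filter_upwards [hF0] with ω hω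
    exact mul_le_mul_of_nonneg_right (le_max_left _ _) hω
  -- Since `α` may be zero, the normalisation to level one divides by some `β` strictly above it.
  obtain ⟨β, hαβ, hβ⟩ := exists_between hF'
  have hβ0 : 0 < β := hα.trans_lt hαβ
  refine ⟨fun ω => β⁻¹ * max (Z ω) 0, (hZm.max measurable_const).const_mul _,
    hzp.const_mul _, fun ω => by positivity, fun W hW => ?_, ?_⟩
  · simp_rw [mul_assoc, integral_const_mul]
    rw [inv_mul_le_iff₀ hβ0, mul_one]
    exact (hW' W hW).trans hαβ.le
  · simp_rw [mul_assoc, integral_const_mul]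
    rwa [lt_inv_mul_iff₀ hβ0, mul_one]

theorem memLp_trunc {f : RV Ω} {m : Measure Ω} [IsFiniteMeasure m]
    (hf : ∀ᵐ ω ∂m, 0 ≤ (f : Ω → ℝ) ω) (n : ℕ) (p : ℝ≥0∞) :
    MemLp (RV.trunc f n : Ω → ℝ) p m := by
  refine MemLp.of_bound (RV.measurable _).aestronglyMeasurable n ?_
  filter_upwards [hf] with ω hω
  rw [RV.trunc_apply, Real.norm_of_nonneg (le_min hω n.cast_nonneg)]
  exact min_le_right _ _

theorem lintegral_withDensity_ofReal {m : Measure Ω} {z : Ω → ℝ} (hz : Measurable z)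
    (hz0 : ∀ ω, 0 ≤ z ω) (hz2 : MemLp z 2 m) {f : RV Ω} (hf : ∀ᵐ ω ∂m, 0 ≤ (f : Ω → ℝ) ω)
    {F : Lp ℝ 2 m} (hF : F =ᵐ[m] (f : Ω → ℝ)) :
    ∫⁻ ω, ENNReal.ofReal ((f : Ω → ℝ) ω) ∂m.withDensity (fun ω => ENNReal.ofReal (z ω)) =
      ENNReal.ofReal (∫ ω, z ω * F ω ∂m) := by
  rw [lintegral_withDensity_eq_lintegral_mul _ hz.ennreal_ofReal
    (RV.measurable f).ennreal_ofReal, ofReal_integral_eq_lintegral_ofReal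
    (f := fun ω => z ω * F ω) (hz2.integrable_mul (Lp.memLp F))]
  · refine lintegral_congr_ae ?_
    filter_upwards [hF] with ω hω
    rw [hω, ENNReal.ofReal_mul (hz0 ω)]
    rfl
  · filter_upwards [hF, hf] with ω hω hf
    rw [hω]
    exact mul_nonneg (hz0 ω) hf

/-- If `j_Q X ∉ j_Q C`, then some finite measure with a density with respect to `Q` lies in the
polar of `C` and separates `X` from `C`. -/
theorem exists_density_separating {C : Set (L0 𝓟)} (hne : C.Nonempty) (hconv : Convex ℝ C)
    (hsol : IsSolidPos C) (hcl : IsSeqOrderClosed C) {Q : Pc 𝓟} {x : RV Ω}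
    (hx : L0.mk 𝓟 x ∈ L0Pos 𝓟) (hQ : jQ Q (L0.mk 𝓟 x) ∉ jQ Q '' C) :
    ∃ z : Ω → ℝ≥0∞, Measurable z ∧
      IsFiniteMeasure (((Q : ProbabilityMeasure Ω) : Measure Ω).withDensity z) ∧
      (∀ c : RV Ω, L0.mk 𝓟 c ∈ C → ∫⁻ ω, ENNReal.ofReal ((c : Ω → ℝ) ω)
        ∂((Q : ProbabilityMeasure Ω) : Measure Ω).withDensity z ≤ 1) ∧
      1 < ∫⁻ ω, ENNReal.ofReal ((x : Ω → ℝ) ω)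
        ∂((Q : ProbabilityMeasure Ω) : Measure Ω).withDensity z := by
  set m := ((Q : ProbabilityMeasure Ω) : Measure Ω)
  have hm : IsDominated 𝓟 m := Pc.isDominated Q
  have hx0 := hm.ae_nonneg hx
  have htr : ∀ (f : RV Ω) (hf : ∀ᵐ ω ∂m, 0 ≤ (f : Ω → ℝ) ω) (n : ℕ),
      (memLp_trunc hf n 2).toLp _ =ᵐ[m] (RV.trunc f n : Ω → ℝ) :=
    fun f hf n => (memLp_trunc hf n 2).coeFn_toLp
  have htr0 : ∀ {f : RV Ω}, (∀ᵐ ω ∂m, 0 ≤ (f : Ω → ℝ) ω) → ∀ n : ℕ,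
      ∀ᵐ ω ∂m, 0 ≤ (RV.trunc f n : Ω → ℝ) ω := fun hf n => by
    filter_upwards [hf] with ω hω
    exact le_min hω n.cast_nonneg
  -- If every truncation of `x` were in the trace, their almost sure limit `x` would agree `Q`-a.s.
  -- with an element of `C`.
  obtain ⟨n, hn⟩ : ∃ n, (memLp_trunc hx0 n 2).toLp _ ∉ l2Trace C m := by
    by_contra! h
    choose c hc hxc using h
    obtain ⟨y, hy, hyx⟩ := exists_mem_ae_eq_of_tendsto hsol hcl (m := m) (x := x) hc (by
      filter_upwards [ae_all_iff.2 fun n => hxc n, ae_all_iff.2 fun n => htr x hx0 n]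
        with ω h1 h2
      exact (RV.tendsto_trunc x ω).congr fun n => (h2 n).symm.trans (h1 n))
    exact hQ ⟨_, hy, jQ_mk_eq_iff.2 hyx⟩
  obtain ⟨z, hz, hz2, hz0, hzC, hzx⟩ := exists_nonneg_separating hne hconv hsol hcl (by
    filter_upwards [htr x hx0 n, htr0 hx0 n] with ω h1 h2
    rw [h1]
    exact h2) hn
  refine ⟨fun ω => ENNReal.ofReal (z ω), hz.ennreal_ofReal,
    isFiniteMeasure_withDensity_ofReal (hz2.integrable one_le_two).2, fun c hc => ?_, ?_⟩
  · have hc0 := hm.ae_nonneg (hsol.1 hc)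
    -- An element of `C` need not be square integrable; its truncations are, they lie in `C` by
    -- solidity, and Fatou recovers the bound.
    refine lintegral_ofReal_le_of_tendsto (ae_of_all _ (RV.tendsto_trunc c)) fun k => ?_
    rw [lintegral_withDensity_ofReal hz hz0 hz2 (htr0 hc0 k) (htr c hc0 k)]
    exact ENNReal.ofReal_le_one.2 (hzC _ ⟨_, hsol.trunc_mem hc k, htr c hc0 k⟩)
  · refine (ENNReal.one_lt_ofReal.2 hzx).trans_le ?_
    rw [← lintegral_withDensity_ofReal hz hz0 hz2 (htr0 hx0 n) (htr x hx0 n)]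
    exact lintegral_mono fun ω => ENNReal.ofReal_le_ofReal (min_le_left _ _)

end Separation

/-! ### The bipolar theorem. -/

section Bipolar

theorem subset_bipolarIn {M : Set (ca 𝓟)} {C : Set (L0 𝓟)} (hC : C ⊆ L0Pos 𝓟) :
    C ⊆ bipolarIn M C := fun X hX => ⟨hC hX, fun _ hμ => hμ.2 X hX⟩

theorem mem_bipolarCa_iff {C : Set (L0 𝓟)} {x : RV Ω} : L0.mk 𝓟 x ∈ bipolarCa C ↔
    L0.mk 𝓟 x ∈ L0Pos 𝓟 ∧ ∀ (m : Measure Ω) [IsFiniteMeasure m], IsDominated 𝓟 m →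
      (∀ c : RV Ω, L0.mk 𝓟 c ∈ C → ∫⁻ ω, ENNReal.ofReal ((c : Ω → ℝ) ω) ∂m ≤ 1) →
      ∫⁻ ω, ENNReal.ofReal ((x : Ω → ℝ) ω) ∂m ≤ 1 := by
  refine and_congr_right fun _ => ⟨fun h m _ hm hc => ?_, fun h μ ⟨hμ, hp⟩ => ?_⟩
  · rw [← posIntegral_caOf m hm]
    refine h _ ⟨caOf_mem_caPos m hm, fun Y hY => ?_⟩
    induction Y using L0.ind with | h y => ?_
    rw [posIntegral_caOf]
    exact hc y hY
  · obtain ⟨m, _, hm, rfl⟩ := exists_eq_caOf hμ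
    rw [posIntegral_caOf]
    exact h m hm fun c hc => (posIntegral_caOf m hm c).symm.trans_le (hp _ hc)

theorem convex_bipolarCa (C : Set (L0 𝓟)) : Convex ℝ (bipolarCa C) := by
  intro X hX Y hY a b ha hb hab
  induction X using L0.ind with | h x => ?_
  induction Y using L0.ind with | h y => ?_
  rw [mem_bipolarCa_iff] at hX hY
  change L0.mk 𝓟 (a • x + b • y) ∈ _
  refine mem_bipolarCa_iff.2 ⟨L0.mk_mem_L0Pos.2 fun P hP => ?_, fun m _ hm hc => ?_⟩
  · filter_upwards [L0.mk_mem_L0Pos.1 hX.1 P hP, L0.mk_mem_L0Pos.1 hY.1 P hP] with ω h1 h2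
    exact add_nonneg (mul_nonneg ha h1) (mul_nonneg hb h2)
  · calc ∫⁻ ω, ENNReal.ofReal (((a • x + b • y : RV Ω) : Ω → ℝ) ω) ∂m
        ≤ ∫⁻ ω, ENNReal.ofReal a * ENNReal.ofReal ((x : Ω → ℝ) ω) +
            ENNReal.ofReal b * ENNReal.ofReal ((y : Ω → ℝ) ω) ∂m := by
          refine lintegral_mono fun ω => ?_
          rw [← ENNReal.ofReal_mul ha, ← ENNReal.ofReal_mul hb]
          exact ENNReal.ofReal_add_le
      _ = ENNReal.ofReal a * ∫⁻ ω, ENNReal.ofReal ((x : Ω → ℝ) ω) ∂m +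
            ENNReal.ofReal b * ∫⁻ ω, ENNReal.ofReal ((y : Ω → ℝ) ω) ∂m := by
          have hx := (RV.measurable x).ennreal_ofReal
          have hy := (RV.measurable y).ennreal_ofReal
          rw [lintegral_add_left (hx.const_mul _), lintegral_const_mul _ hx,
            lintegral_const_mul _ hy]
      _ ≤ ENNReal.ofReal a * 1 + ENNReal.ofReal b * 1 := by
          gcongr
          exacts [hX.2 m hm hc, hY.2 m hm hc]
      _ = 1 := by rw [mul_one, mul_one, ← ENNReal.ofReal_add ha hb, hab, ENNReal.ofReal_one]

theorem isSolidPos_bipolarCa (C : Set (L0 𝓟)) : IsSolidPos (bipolarCa C) := by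
  refine ⟨fun X hX => hX.1, fun X hX Y hY hYX => ?_⟩
  induction X using L0.ind with | h x => ?_
  induction Y using L0.ind with | h y => ?_
  rw [mem_bipolarCa_iff] at hX ⊢
  refine ⟨hY, fun m _ hm hc => (lintegral_mono_ae ?_).trans (hX.2 m hm hc)⟩
  filter_upwards [hm.ae_le hYX] with ω hω
  exact ENNReal.ofReal_le_ofReal hω

/-- Order limits are almost sure limits under every dominated measure, so Fatou preserves each
constraint; positivity passes to the limit under each `P ∈ 𝓟`. -/
theorem isSeqOrderClosed_bipolarCa (C : Set (L0 𝓟)) : IsSeqOrderClosed (bipolarCa C) := by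
  intro X X₀ hX hlim
  have hex : ∀ n, ∃ x : RV Ω, L0.mk 𝓟 x = X n := fun n => by
    induction X n using L0.ind with | h x => exact ⟨x, rfl⟩
  choose x hx using hex
  obtain rfl : (fun n => L0.mk 𝓟 (x n)) = X := funext hx
  induction X₀ using L0.ind with | h y => ?_
  have hX := fun n => mem_bipolarCa_iff.1 (hX n)
  refine mem_bipolarCa_iff.2 ⟨L0.mk_mem_L0Pos.2 fun P hP => ?_, fun m _ hm hc =>
    lintegral_ofReal_le_of_tendsto (hlim.ae_tendsto hm) fun n => (hX n).2 m hm hc⟩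
  filter_upwards [hlim.ae_tendsto (isDominated_of_mem hP),
    ae_all_iff.2 fun n => L0.mk_mem_L0Pos.1 (hX n).1 P hP] with ω h1 h2
  exact ge_of_tendsto' h1 h2

theorem mem_iInter_jQ_iff {𝒬 : Set (Pc 𝓟)} {C : Set (L0 𝓟)} {X : L0 𝓟} :
    X ∈ ⋂ Q ∈ 𝒬, jQ Q ⁻¹' (jQ Q '' C) ↔ ∀ Q ∈ 𝒬, jQ Q X ∈ jQ Q '' C := by
  simp only [Set.mem_iInter, Set.mem_preimage]

theorem isSensitive_of_forall {C : Set (L0 𝓟)}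
    (h : ∀ x : RV Ω, (∀ Q : Pc 𝓟, jQ Q (L0.mk 𝓟 x) ∈ jQ Q '' C) → L0.mk 𝓟 x ∈ C) :
    IsSensitive C := by
  refine (Set.subset_iInter fun _ => Set.subset_preimage_image _ _).antisymm fun X hX => ?_
  simp only [Set.mem_iInter, Set.mem_preimage] at hX
  induction X using L0.ind with | h x => ?_
  exact h x hX

theorem exists_mk_of_jQ_mem {C : Set (L0 𝓟)} {Q : Pc 𝓟} {x : RV Ω}
    (h : jQ Q (L0.mk 𝓟 x) ∈ jQ Q '' C) : ∃ y : RV Ω, L0.mk 𝓟 y ∈ C ∧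
      (y : Ω → ℝ) =ᵐ[((Q : ProbabilityMeasure Ω) : Measure Ω)] (x : Ω → ℝ) := by
  obtain ⟨Y, hY, h⟩ := h
  induction Y using L0.ind with | h y => ?_
  exact ⟨y, hY, jQ_mk_eq_iff.1 h⟩

theorem mk_mem_L0Pos_of_jQ_mem {C : Set (L0 𝓟)} (hC : C ⊆ L0Pos 𝓟) {x : RV Ω}
    (h : ∀ Q : Pc 𝓟, jQ Q (L0.mk 𝓟 x) ∈ jQ Q '' C) : L0.mk 𝓟 x ∈ L0Pos 𝓟 := by
  refine L0.mk_mem_L0Pos.2 fun P hP => ?_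
  -- Every `P ∈ 𝓟` is itself in `𝔓_c`, so the hypothesis applies to it.
  obtain ⟨y, hy, hyx⟩ := exists_mk_of_jQ_mem (h ⟨P, isDominated_of_mem hP⟩)
  filter_upwards [hyx, L0.mk_mem_L0Pos.1 (hC hy) P hP] with ω h1 h2
  exact h1 ▸ h2

/-- A nonzero constraining measure is a multiple of one `Q`, so its constraint depends only on the
class under `Q` and can be checked on a `Q`-a.s. equal element of the bipolar. -/
theorem isSensitive_bipolarCa (C : Set (L0 𝓟)) : IsSensitive (bipolarCa C) := by
  refine isSensitive_of_forall fun x hx => mem_bipolarCa_iff.2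
    ⟨mk_mem_L0Pos_of_jQ_mem (isSolidPos_bipolarCa C).1 hx, fun m _ hm hc => ?_⟩
  by_cases h0 : m = 0
  · simp [h0]
  obtain ⟨Q, r, -, hQ⟩ := hm.exists_eq_smul h0
  obtain ⟨y, hy, hyx⟩ := exists_mk_of_jQ_mem (hx Q)
  refine le_of_eq_of_le (lintegral_congr_ae ?_) ((mem_bipolarCa_iff.1 hy).2 m hm hc)
  rw [hQ]
  refine Measure.ae_smul_measure ?_ _
  filter_upwards [hyx] with ω hω
  rw [hω]

/-- The nontrivial half of the bipolar theorem, for the polar in a set `M` of measures that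
contains every positive finite measure with a density with respect to an element of `𝒬`. -/
theorem bipolarIn_subset {M : Set (ca 𝓟)} {C : Set (L0 𝓟)} {𝒬 : Set (Pc 𝓟)} (hne : C.Nonempty)
    (hconv : Convex ℝ C) (hsol : IsSolidPos C) (hcl : IsSeqOrderClosed C)
    (hred : C = ⋂ Q ∈ 𝒬, jQ Q ⁻¹' (jQ Q '' C))
    (hM : ∀ Q ∈ 𝒬, ∀ z : Ω → ℝ≥0∞, Measurable z →
      ∀ [IsFiniteMeasure (((Q : ProbabilityMeasure Ω) : Measure Ω).withDensity z)],
        caOf _ ((Pc.isDominated Q).withDensity z) ∈ M) : bipolarIn M C ⊆ C := by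
  intro X hX
  rw [hred, mem_iInter_jQ_iff]
  intro Q hQ
  by_contra hXC
  induction X using L0.ind with | h x => ?_
  obtain ⟨z, hz, _, hzC, hzx⟩ := exists_density_separating hne hconv hsol hcl hX.1 hXC
  rw [← posIntegral_caOf _ ((Pc.isDominated Q).withDensity z)] at hzx
  refine hzx.not_ge (hX.2 _ ⟨hM Q hQ z hz, fun Y hY => ?_⟩)
  induction Y using L0.ind with | h y => ?_
  rw [posIntegral_caOf]
  exact hzC y hY

/-- The order support shrinks to its intersection with `{z ≠ 0}`, on which `m` and `z dm` have the
same null events. This keeps the separating measure inside `sca_c`. -/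
theorem IsSupported.withDensity {m : Measure Ω} (hm : IsSupported 𝓟 m) {z : Ω → ℝ≥0∞}
    (hz : Measurable z) : IsSupported 𝓟 (m.withDensity z) := by
  obtain ⟨S, hS, hS0, h⟩ := hm
  have hA : MeasurableSet {ω | z ω ≠ 0} := (hz (measurableSet_singleton 0)).compl
  refine ⟨S ∩ {ω | z ω ≠ 0}, hS.inter hA, ?_, fun N hN hN0 => ?_⟩
  · rw [withDensity_apply_eq_zero hz]
    refine measure_mono_null (fun ω hω => ?_) hS0
    exact fun hωS => hω.2 ⟨hωS, hω.1⟩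
  · rw [withDensity_apply_eq_zero hz] at hN0
    refine (h (N ∩ {ω | z ω ≠ 0}) (hN.inter hA) (measure_mono_null ?_ hN0)).mono ?_ <;>
      intro ω hω <;> simp_all

theorem eq_bipolarCa_iff {C : Set (L0 𝓟)} (hne : C.Nonempty) :
    C = bipolarCa C ↔ Convex ℝ C ∧ IsSolidPos C ∧ IsSeqOrderClosed C ∧ IsSensitive C := by
  refine ⟨fun h => ?_, fun ⟨hconv, hsol, hcl, hsens⟩ => ?_⟩
  · rw [h]
    exact ⟨convex_bipolarCa C, isSolidPos_bipolarCa C, isSeqOrderClosed_bipolarCa C,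
      isSensitive_bipolarCa C⟩
  · exact (subset_bipolarIn hsol.1).antisymm (bipolarIn_subset (𝒬 := Set.univ) hne hconv hsol hcl
      (by simpa [IsSensitive] using hsens) fun Q _ z _ _ => caOf_mem_caPos _ _)

/-- Intersecting over all of `𝔓_c` imposes at least the conditions indexed by `𝒬`. -/
theorem IsReductionSet.isSensitive {𝒬 : Set (Pc 𝓟)} {C : Set (L0 𝓟)} (h : IsReductionSet 𝒬 C) :
    IsSensitive C := by
  refine isSensitive_of_forall fun x hx => ?_
  rw [h.2, mem_iInter_jQ_iff]
  exact fun Q _ => hx Q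

end Bipolar

/-! ### Convexity, solidity and weak closedness of the polars. -/

section Polar

theorem caOf_smul_add_smul {m n : Measure Ω} [IsFiniteMeasure m] [IsFiniteMeasure n]
    (hm : IsDominated 𝓟 m) (hn : IsDominated 𝓟 n) (a b : NNReal) :
    (a : ℝ) • caOf m hm + (b : ℝ) • caOf n hn =
      caOf (a • m + b • n) ((hm.smul a).add (hn.smul b)) := by
  refine Subtype.ext ?_
  change (a : ℝ) • m.toSignedMeasure + (b : ℝ) • n.toSignedMeasure =
    (a • m + b • n).toSignedMeasure
  rw [Measure.toSignedMeasure_add, Measure.toSignedMeasure_smul, Measure.toSignedMeasure_smul]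
  rfl

theorem convex_caPos : Convex ℝ (caPos 𝓟) := by
  intro μ hμ ν hν a b ha hb _
  obtain ⟨m, _, hm, rfl⟩ := exists_eq_caOf hμ
  obtain ⟨n, _, hn, rfl⟩ := exists_eq_caOf hν
  lift a to NNReal using ha
  lift b to NNReal using hb
  rw [caOf_smul_add_smul]
  exact caOf_mem_caPos _ _

theorem isSupported_zero : IsSupported 𝓟 (0 : Measure Ω) :=
  ⟨∅, .empty, rfl, fun N _ _ => by simpa using isPolar_empty 𝓟⟩

theorem IsSupported.smul {m : Measure Ω} (hm : IsSupported 𝓟 m) (a : NNReal) :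
    IsSupported 𝓟 (a • m) := by
  -- For `a = 0` the old support fails in general, since every event is null for the zero measure;
  -- the empty set serves instead.
  obtain rfl | ha := eq_or_ne a 0
  · rw [zero_smul]
    exact isSupported_zero
  obtain ⟨S, hS, hS0, h⟩ := hm
  exact ⟨S, hS, by simp [hS0], fun N hN hN0 => h N hN (by simpa [ha] using hN0)⟩

/-- The union of the two supports works, because an event null for the sum is null for each summand.
-/
theorem IsSupported.add {m n : Measure Ω} (hm : IsSupported 𝓟 m) (hn : IsSupported 𝓟 n) :
    IsSupported 𝓟 (m + n) := by
  obtain ⟨S, hS, hS0, h⟩ := hm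
  obtain ⟨T, hT, hT0, k⟩ := hn
  refine ⟨S ∪ T, hS.union hT, ?_, fun N hN hN0 => ?_⟩
  · rw [Measure.add_apply, add_eq_zero]
    exact ⟨measure_mono_null (by simp) hS0, measure_mono_null (by simp) hT0⟩
  · rw [Measure.add_apply, add_eq_zero, Set.inter_union_distrib_left] at hN0
    rw [Set.inter_union_distrib_left]
    exact (h N hN (measure_mono_null Set.subset_union_left hN0.1)).union
      (k N hN (measure_mono_null Set.subset_union_right hN0.2))

theorem convex_scaPos : Convex ℝ (scaPos 𝓟) := by
  rintro μ ⟨hμs, hμ⟩ ν ⟨hνs, hν⟩ a b ha hb hab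
  refine ⟨?_, convex_caPos hμ hν ha hb hab⟩
  obtain ⟨m, _, hm, rfl⟩ := exists_eq_caOf hμ
  obtain ⟨n, _, hn, rfl⟩ := exists_eq_caOf hν
  lift a to NNReal using ha
  lift b to NNReal using hb
  rw [caOf_mem_sca_iff] at hμs hνs
  rw [caOf_smul_add_smul, caOf_mem_sca_iff]
  exact (hμs.smul a).add (hνs.smul b)

theorem caOf_mem_polarIn_iff {M : Set (ca 𝓟)} {C : Set (L0 𝓟)} {m : Measure Ω}
    [IsFiniteMeasure m] {hm : IsDominated 𝓟 m} : caOf m hm ∈ polarIn M C ↔ caOf m hm ∈ M ∧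
      ∀ c : RV Ω, L0.mk 𝓟 c ∈ C → ∫⁻ ω, ENNReal.ofReal ((c : Ω → ℝ) ω) ∂m ≤ 1 := by
  refine and_congr_right fun _ => ⟨fun h c hc => ?_, fun h X hX => ?_⟩
  · exact (posIntegral_caOf m hm c).symm.trans_le (h _ hc)
  · induction X using L0.ind with | h x => ?_
    exact (posIntegral_caOf m hm x).trans_le (h x hX)

theorem convex_polarIn {M : Set (ca 𝓟)} (hM : M ⊆ caPos 𝓟) (hconv : Convex ℝ M)
    (C : Set (L0 𝓟)) : Convex ℝ (polarIn M C) := by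
  intro μ hμ ν hν a b ha hb hab
  have hmem := hconv hμ.1 hν.1 ha hb hab
  obtain ⟨m, _, hm, rfl⟩ := exists_eq_caOf (hM hμ.1)
  obtain ⟨n, _, hn, rfl⟩ := exists_eq_caOf (hM hν.1)
  lift a to NNReal using ha
  lift b to NNReal using hb
  rw [caOf_mem_polarIn_iff] at hμ hν
  rw [caOf_smul_add_smul] at hmem ⊢
  refine caOf_mem_polarIn_iff.2 ⟨hmem, fun c hc => ?_⟩
  rw [lintegral_add_measure, lintegral_smul_measure, lintegral_smul_measure]
  calc _ ≤ a • (1 : ℝ≥0∞) + b • (1 : ℝ≥0∞) := by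
        gcongr
        exacts [hμ.2 c hc, hν.2 c hc]
    _ = 1 := by
        rw [← add_smul, show a + b = 1 from NNReal.eq hab, one_smul]

theorem isSolidMeas_polarIn {M : Set (ca 𝓟)} (hM : M ⊆ caPos 𝓟) (C : Set (L0 𝓟)) :
    IsSolidMeas M (polarIn M C) := by
  refine ⟨fun μ hμ => hμ.1, fun μ hμ ν hν hle => ?_⟩
  obtain ⟨m, _, hm, rfl⟩ := exists_eq_caOf (hM hμ.1)
  obtain ⟨n, _, hn, rfl⟩ := exists_eq_caOf (hM hν)
  have hnm : n ≤ m := Measure.le_iff.2 fun A hA => by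
    have := hle A hA
    rw [caOf_apply _ _ hA, caOf_apply _ _ hA] at this
    exact (ENNReal.toReal_le_toReal (measure_ne_top _ _) (measure_ne_top _ _)).1 this
  exact caOf_mem_polarIn_iff.2 ⟨hν, fun c hc =>
    (lintegral_mono' hnm le_rfl).trans ((caOf_mem_polarIn_iff.1 hμ).2 c hc)⟩

theorem pairing_caOf (m : Measure Ω) [IsFiniteMeasure m] (hm : IsDominated 𝓟 m) (f : RV Ω)
    (hf : L0.mk 𝓟 f ∈ Linf 𝓟) :
    pairing (caOf m hm) ⟨L0.mk 𝓟 f, hf⟩ = ∫ ω, (f : Ω → ℝ) ω ∂m := by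
  let j : JordanDecomposition Ω :=
    { posPart := m
      negPart := 0
      mutuallySingular := Measure.MutuallySingular.zero_right }
  have h : m.toSignedMeasure.toJordanDecomposition = j :=
    SignedMeasure.toJordanDecomposition_eq (by simp [j, JordanDecomposition.toSignedMeasure])
  change (∫ ω, (f : Ω → ℝ) ω ∂m.toSignedMeasure.toJordanDecomposition.posPart) -
    ∫ ω, (f : Ω → ℝ) ω ∂m.toSignedMeasure.toJordanDecomposition.negPart = _
  simp [h, j]

theorem mk_mem_Linf {f : RV Ω} {a : ℝ} (h : ∀ P ∈ 𝓟, ∀ᵐ ω ∂(P : Measure Ω),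
    |(f : Ω → ℝ) ω| ≤ a) : L0.mk 𝓟 f ∈ Linf 𝓟 := by
  refine ⟨|a| + 1, by positivity, ?_⟩
  rw [L0.abs_mk, ← L0.mk_algebraMap]
  refine L0.mk_le_iff.2 fun P hP => ?_
  filter_upwards [h P hP] with ω hω
  exact hω.trans ((le_abs_self a).trans (le_add_of_nonneg_right zero_le_one))

theorem mk_restrict_one_mem_Linf {A : Set Ω} (hA : MeasurableSet A) :
    L0.mk 𝓟 (RV.restrict 1 hA) ∈ Linf 𝓟 :=
  mk_mem_Linf (a := 1) fun _ _ => ae_of_all _ fun ω => by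
    by_cases h : ω ∈ A <;> simp [RV.restrict, h]

theorem mk_trunc_mem_Linf {f : RV Ω} (hf : L0.mk 𝓟 f ∈ L0Pos 𝓟) (n : ℕ) :
    L0.mk 𝓟 (RV.trunc f n) ∈ Linf 𝓟 := by
  refine mk_mem_Linf (a := n) fun P hP => ?_
  filter_upwards [L0.mk_mem_L0Pos.1 (RV.mk_trunc_mem_L0Pos hf n) P hP] with ω hω
  rw [abs_of_nonneg hω]
  exact min_le_right _ _

/-- Evaluation on an event is a pairing with a bounded function, so positivity of a signed measure
is a weakly closed condition. -/
theorem pairing_restrict_one (μ : ca 𝓟) {A : Set Ω} (hA : MeasurableSet A) :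
    pairing μ ⟨L0.mk 𝓟 (RV.restrict 1 hA), mk_restrict_one_mem_Linf hA⟩ =
      (μ : SignedMeasure Ω) A := by
  conv_rhs => rw [← SignedMeasure.toSignedMeasure_toJordanDecomposition (μ : SignedMeasure Ω)]
  change (∫ ω, A.indicator 1 ω ∂(μ : SignedMeasure Ω).toJordanDecomposition.posPart) -
    ∫ ω, A.indicator 1 ω ∂(μ : SignedMeasure Ω).toJordanDecomposition.negPart = _
  rw [integral_indicator_one hA, integral_indicator_one hA, JordanDecomposition.toSignedMeasure,
    sub_apply, Measure.toSignedMeasure_apply_measurable hA,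
    Measure.toSignedMeasure_apply_measurable hA]

/-- Elements of `C` may be unbounded and then give no weakly continuous functional directly. Their
truncations are bounded, and since these converge to `c`, bounds on all of them give the bound on
`c`. -/
theorem mem_polarCa_iff {C : Set (L0 𝓟)} (hC : C ⊆ L0Pos 𝓟) {μ : ca 𝓟} : μ ∈ polarCa C ↔
    (∀ (A : Set Ω) (hA : MeasurableSet A),
      0 ≤ pairing μ ⟨L0.mk 𝓟 (RV.restrict 1 hA), mk_restrict_one_mem_Linf hA⟩) ∧
    ∀ (c : RV Ω) (hc : L0.mk 𝓟 c ∈ C) (n : ℕ),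
      pairing μ ⟨L0.mk 𝓟 (RV.trunc c n), mk_trunc_mem_Linf (hC hc) n⟩ ≤ 1 := by
  have hpos : μ ∈ caPos 𝓟 ↔ ∀ (A : Set Ω) (hA : MeasurableSet A),
      0 ≤ pairing μ ⟨L0.mk 𝓟 (RV.restrict 1 hA), mk_restrict_one_mem_Linf hA⟩ :=
    forall₂_congr fun A hA => by rw [pairing_restrict_one]; rfl
  rw [← hpos]
  refine ⟨fun h => ⟨h.1, ?_⟩, fun ⟨hμ, h⟩ => ?_⟩
  · obtain ⟨m, _, hm, rfl⟩ := exists_eq_caOf h.1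
    intro c hc n
    have hc0 := hm.ae_nonneg (RV.mk_trunc_mem_L0Pos (hC hc) n)
    rw [pairing_caOf, integral_eq_lintegral_of_nonneg_ae hc0
      (RV.measurable _).aestronglyMeasurable]
    refine ENNReal.toReal_le_of_le_ofReal zero_le_one ?_
    rw [ENNReal.ofReal_one]
    exact (lintegral_mono fun ω => ENNReal.ofReal_le_ofReal (min_le_left _ _)).trans
      ((caOf_mem_polarIn_iff.1 h).2 c hc)
  · obtain ⟨m, _, hm, rfl⟩ := exists_eq_caOf hμ
    refine caOf_mem_polarIn_iff.2 ⟨hμ, fun c hc =>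
      lintegral_ofReal_le_of_tendsto (ae_of_all _ (RV.tendsto_trunc c)) fun n => ?_⟩
    have := h c hc n
    rw [pairing_caOf] at this
    rw [← ofReal_integral_eq_lintegral_ofReal
      ((memLp_trunc (hm.ae_nonneg (hC hc)) n 1).integrable le_rfl)
      (hm.ae_nonneg (RV.mk_trunc_mem_L0Pos (hC hc) n))]
    exact ENNReal.ofReal_le_one.2 this

theorem isClosed_preimage_polarCa (M : Set (ca 𝓟)) {C : Set (L0 𝓟)} (hC : C ⊆ L0Pos 𝓟) :
    IsClosed[weakTopology M] ((↑) ⁻¹' polarCa C : Set M) := by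
  let T : Set (Linf 𝓟 → ℝ) := {φ | (∀ (A : Set Ω) (hA : MeasurableSet A),
      0 ≤ φ ⟨L0.mk 𝓟 (RV.restrict 1 hA), mk_restrict_one_mem_Linf hA⟩) ∧
    ∀ (c : RV Ω) (hc : L0.mk 𝓟 c ∈ C) (n : ℕ),
      φ ⟨L0.mk 𝓟 (RV.trunc c n), mk_trunc_mem_Linf (hC hc) n⟩ ≤ 1}
  -- `T` is an intersection of closed half-spaces in the product space, each constraining one
  -- coordinate. No property of `M` enters, so the same argument serves `ca_c` and `sca_c`.
  refine isClosed_induced_iff.2 ⟨T, ?_, ?_⟩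
  · simp only [T, Set.ofPred_and, Set.ofPred_forall]
    exact (isClosed_iInter fun A => isClosed_iInter fun hA =>
      isClosed_le continuous_const (continuous_apply _)).inter <|
      isClosed_iInter fun c => isClosed_iInter fun hc => isClosed_iInter fun n =>
        isClosed_le (continuous_apply _) continuous_const
  · ext μ
    exact (mem_polarCa_iff hC).symm

theorem polarSca_eq (C : Set (L0 𝓟)) : polarSca C = sca 𝓟 ∩ polarCa C :=
  Set.ext fun _ => and_assoc

end Polar
end RobustModel

open RobustModel
theorem mainTheorem3 {Ω : Type*} [MeasurableSpace Ω]
    (𝓟 : Set (ProbabilityMeasure Ω)) (h𝓟 : 𝓟.Nonempty)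
    (C : Set (L0 𝓟)) (hC : C.Nonempty) (hCpos : C ⊆ L0Pos 𝓟) :
    bipolarCa C = bipolar C ∧
    (C = bipolarCa C ↔
      Convex ℝ C ∧ IsSolidPos C ∧ IsSeqOrderClosed C ∧ IsSensitive C) ∧
    (∀ 𝒬 : Set (Pc 𝓟), Convex ℝ C → IsSolidPos C → IsSeqOrderClosed C →
      IsReductionSet 𝒬 C →
      (∀ Q ∈ 𝒬, IsSupported 𝓟 ((Q : ProbabilityMeasure Ω) : Measure Ω)) →
      C = bipolar C ∧ bipolar C = bipolarSca C) ∧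
    (Convex ℝ (polarCa C) ∧ IsSolidMeas (caPos 𝓟) (polarCa C) ∧
      IsWeaklyClosedIn Set.univ (polarCa C)) ∧
    (Convex ℝ (polarSca C) ∧ IsSolidMeas (scaPos 𝓟) (polarSca C) ∧
      IsWeaklyClosedIn (sca 𝓟) (polarSca C)) := by
  refine ⟨bipolarCa_eq_bipolar C, eq_bipolarCa_iff hC, ?_,
    ⟨convex_polarIn subset_rfl convex_caPos C, isSolidMeas_polarIn subset_rfl C,
      Set.subset_univ _, isClosed_preimage_polarCa _ hCpos⟩,
    ⟨convex_polarIn Set.inter_subset_right convex_scaPos C,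
      isSolidMeas_polarIn Set.inter_subset_right C, fun μ hμ => hμ.1.1, ?_⟩⟩
  · intro 𝒬 hconv hsol hcl hred hsupp
    have h1 : C = bipolarCa C := (eq_bipolarCa_iff hC).2 ⟨hconv, hsol, hcl, hred.isSensitive⟩
    have h2 : bipolarSca C ⊆ C := bipolarIn_subset hC hconv hsol hcl hred.2 fun Q hQ z hz _ =>
      ⟨(caOf_mem_sca_iff _ _).2 ((hsupp Q hQ).withDensity hz), caOf_mem_caPos _ _⟩
    rw [← bipolarCa_eq_bipolar, ← h1]
    exact ⟨rfl, (subset_bipolarIn hCpos).antisymm h2⟩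
  · rw [polarSca_eq]
    -- `sca_c` itself need not be weakly closed in `ca_c`; relative to `sca_c`, being supported is
    -- no condition.
    have : ((↑) ⁻¹' (sca 𝓟 ∩ polarCa C) : Set (sca 𝓟)) = (↑) ⁻¹' polarCa C :=
      Set.ext fun μ => and_iff_right μ.2
    rw [this]
    exact isClosed_preimage_polarCa _ hCpos
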